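/- **Setting.** For each sample size $n$ let $X=X_n\in\mathbb R^{n\times p_n}$ be a design matrix of rank $R_n$ such that $X_S^TX_S$ is nonsingular for every $S\subseteq\{1,\dots,p_n\}$ with $|S|\le R_n$ ($X_S$ denotes the columns of $X$ with index in $S$), and let $\tilde X=\tilde X_n\in\mathbb R^{d\times p_n}$ be a new design matrix, with $d$ fixed. For $\beta^\star\in\mathbb R^{p_n}$ let $S^\star=\{j:\beta^\star_j\ne0\}$, $s^\star=|S^\star|$, and let $E_{\beta^\star}$ be the expectation under $y\sim N_n(X\beta^\star,\sigma_0^2I_n)$, where $\sigma_0^2=\sigma_{0,n}^2$ (for instance constant) satisfies $0<d_1<\sigma_0^2<d_2<\infty$ with $d_1,d_2$ not depending on $n$. Put $\hat\beta_S=(X_S^TX_S)^{-1}X_S^Ty$. Fix constants $0<\alpha<1$ and $\gamma,a_0,b_0,a,c>0$. The empirical prior is: $S$ has prior probability $\pi(S)=\binom{p_n}{|S|}^{-1}f_n(|S|)$, where $f_n$ is the probability mass function with $f_n(s)\propto(cp_n^a)^{-s}$ for $0\le s\le R_n$ and $f_n(s)=0$ for $s>R_n$; $\sigma^2\sim IG(a_0,b_0)$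 (inverse gamma, shape $a_0$, scale $b_0$), independent of $S$; $\beta_S\mid S,\sigma^2\sim N_{|S|}(\hat\beta_S,\sigma^2\gamma^{-1}(X_S^TX_S)^{-1})$ and $\beta_{S^c}=0$. The posterior is proportional to this prior times the fractional likelihood $(2\pi\sigma^2)^{-n\alpha/2}\exp\{-\frac{\alpha}{2\sigma^2}\|y-X\beta\|^2\}$. Let $\pi^n(S)$ be the posterior probability of the model $S$, let $f^n_{\tilde X}(\cdot\mid S)$ be the law of $\tilde y$ when $\tilde y\mid\beta,\sigma^2\sim N_d(\tilde X\beta,\sigma^2I_d)$ and $(\beta,\sigma^2)$ follows the posterior given $S$, and let $f^n_{\tilde X}=\sum_S\pi^n(S)f^n_{\tilde X}(\cdot\mid S)$ be the posterior predictive distribution. Let $H^2(P,Q)=\int(\sqrt{dP}-\sqrt{dQ})^2$ be the squared Hellinger distance and $d_{TV}(P,Q)=\sup_A|P(A)-Q(A)|$ the total variation distance. **Theorem.** Let $B_n\subseteq\mathbb R^{p_n}$ be classes of true coefficient vectors such that, uniformly in $\beta^\star\in B_n$ as $n\to\infty$, $s^\star=o(\sqrt n/\log n)$ and $E_{\beta^\star}\pi^n(S^\star)\to1$.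 Then $$E_{\beta^\star}H^2\Bigl(f^n_{\tilde X},\,N_d\bigl(\tilde X_{S^\star}\hat\beta_{S^\star},\ \sigma_0^2\bigl[I_d+\tfrac1{\alpha+\gamma}\tilde X_{S^\star}(X_{S^\star}^TX_{S^\star})^{-1}\tilde X_{S^\star}^T\bigr]\bigr)\Bigr)\to0$$ uniformly in $\beta^\star\in B_n$ as $n\to\infty$, and the same holds with $d_{TV}$ in place of $H^2$. (Both distances are measurable functions of $y$, so that the expectations make sense.) -/

import Mathlib

open MeasureTheory ProbabilityTheory Filter Topology
open scoped ENNReal Matrix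

noncomputable section

namespace EmpPrior

/-- Hyperparameters of the procedure: the power `alpha ∈ (0, 1)` of the fractional likelihood, the
prior precision factor `gamma`, the inverse gamma parameters `a0`, `b0`, and the constants `a`, `c`
of the prior on the model size. They do not depend on the sample size. -/
structure Hyper where
  alpha : ℝ
  gamma : ℝ
  a0 : ℝ
  b0 : ℝ
  a : ℝ
  c : ℝ
  alpha_pos : 0 < alpha
  alpha_lt_one : alpha < 1
  gamma_pos : 0 < gamma
  a0_pos : 0 < a0
  b0_pos : 0 < b0
  a_pos : 0 < a
  c_pos : 0 < c

section Design

variable {m p : ℕ}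

/-- `X_S`: the columns of `X` with index in `S`. -/
def cols (X : Matrix (Fin m) (Fin p) ℝ) (S : Finset (Fin p)) : Matrix (Fin m) S ℝ :=
  X.submatrix id (fun j => (j : Fin p))

/-- `X_Sᵀ X_S`. -/
def gram (X : Matrix (Fin m) (Fin p) ℝ) (S : Finset (Fin p)) : Matrix S S ℝ :=
  (cols X S)ᵀ * cols X S

/-- `X_S b` for a coefficient vector `b` indexed by `S`. -/
def fit (X : Matrix (Fin m) (Fin p) ℝ) (S : Finset (Fin p)) (b : EuclideanSpace ℝ S) :
    EuclideanSpace ℝ (Fin m) :=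
  WithLp.toLp 2 (cols X S *ᵥ b.ofLp)

/-- The least squares estimator `(X_Sᵀ X_S)⁻¹ X_Sᵀ y`. -/
def lse (X : Matrix (Fin m) (Fin p) ℝ) (S : Finset (Fin p)) (y : EuclideanSpace ℝ (Fin m)) :
    EuclideanSpace ℝ S :=
  WithLp.toLp 2 ((gram X S)⁻¹ *ᵥ ((cols X S)ᵀ *ᵥ y.ofLp))

/-- The support `S_β = {j : β_j ≠ 0}`. -/
def supp (β : Fin p → ℝ) : Finset (Fin p) :=
  Finset.univ.filter (fun j => β j ≠ 0)

/-- The law `N_m(X β, σ₀² I_m)` of the data under the coefficient vector `β`. -/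
def dataLaw (X : Matrix (Fin m) (Fin p) ℝ) (sigma0 : ℝ) (β : Fin p → ℝ) :
    Measure (EuclideanSpace ℝ (Fin m)) :=
  multivariateGaussian (WithLp.toLp 2 (X *ᵥ β)) (sigma0 ^ 2 • (1 : Matrix (Fin m) (Fin m) ℝ))

end Design

section Distributions

/-- The inverse gamma law with shape `a` and scale `b`: the law of `1 / G` where `G` has the gamma
law with shape `a` and rate `b`. -/
def inverseGamma (a b : ℝ) : Measure ℝ :=
  (gammaMeasure a b).map (fun x => x⁻¹)

variable {Ω : Type*} [MeasurableSpace Ω]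

/-- The squared Hellinger distance `∫ (√(dP/dμ) - √(dQ/dμ))² dμ`, with values in `[0, 2]` on
probability measures, computed with the dominating measure `μ = P + Q`. -/
def hellingerSq (P Q : Measure Ω) : ℝ≥0∞ :=
  ∫⁻ x, ENNReal.ofReal
    ((√(P.rnDeriv (P + Q) x).toReal - √(Q.rnDeriv (P + Q) x).toReal) ^ 2) ∂(P + Q)

/-- The total variation distance `sup_A |P(A) - Q(A)|`. -/
def tvDist (P Q : Measure Ω) : ℝ≥0∞ :=
  ⨆ (A : Set Ω) (_ : MeasurableSet A), ENNReal.ofReal |P.real A - Q.real A|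

end Distributions

section Bayes

variable {n p d : ℕ} (h : Hyper)

/-- Prior probability of the model `S`: `(p choose s)⁻¹ f(s)` with `s = |S|`, where `f` is the
probability mass function on `{0, …, rank X}` with `f(s) ∝ (c p^a)^(-s)`. -/
def modelPrior (X : Matrix (Fin n) (Fin p) ℝ) (S : Finset (Fin p)) : ℝ≥0∞ :=
  if S.card ≤ X.rank then
    ENNReal.ofReal (((p.choose S.card : ℝ))⁻¹ *
      (((h.c * (p : ℝ) ^ h.a) ^ S.card)⁻¹ /
        ∑ k ∈ Finset.range (X.rank + 1), ((h.c * (p : ℝ) ^ h.a) ^ k)⁻¹))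
  else 0

/-- Empirical prior of `(β_S, σ²)` given the model `S`:
`σ² ∼ IG(a₀, b₀)` and `β_S | σ² ∼ N(lse, σ² γ⁻¹ (X_Sᵀ X_S)⁻¹)`; the other coordinates of `β`
vanish. -/
def paramPrior (X : Matrix (Fin n) (Fin p) ℝ) (S : Finset (Fin p))
    (y : EuclideanSpace ℝ (Fin n)) : Measure (EuclideanSpace ℝ S × ℝ) :=
  (inverseGamma h.a0 h.b0).bind fun v =>
    (multivariateGaussian (lse X S y) ((v / h.gamma) • (gram X S)⁻¹)).map fun b => (b, v)

/-- The fractional likelihood `(2πσ²)^(-nα/2) exp(-α ‖y - X β‖² / (2σ²))`, at `β` supported in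
`S`. -/
def fracLik (X : Matrix (Fin n) (Fin p) ℝ) (S : Finset (Fin p))
    (y : EuclideanSpace ℝ (Fin n)) (θ : EuclideanSpace ℝ S × ℝ) : ℝ≥0∞ :=
  ENNReal.ofReal ((2 * Real.pi * θ.2) ^ (-(n * h.alpha / 2)) *
    Real.exp (-(h.alpha / (2 * θ.2)) * ‖y - fit X S θ.1‖ ^ 2))

/-- Prior of `(β_S, σ²)` given `S`, times the fractional likelihood. -/
def unnormPosterior (X : Matrix (Fin n) (Fin p) ℝ) (S : Finset (Fin p))
    (y : EuclideanSpace ℝ (Fin n)) : Measure (EuclideanSpace ℝ S × ℝ) :=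
  (paramPrior h X S y).withDensity (fracLik h X S y)

/-- Conditional posterior of `(β_S, σ²)` given `S`. -/
def condPosterior (X : Matrix (Fin n) (Fin p) ℝ) (S : Finset (Fin p))
    (y : EuclideanSpace ℝ (Fin n)) : Measure (EuclideanSpace ℝ S × ℝ) :=
  (unnormPosterior h X S y Set.univ)⁻¹ • unnormPosterior h X S y

/-- Marginal posterior probability `πⁿ(S)` of the model `S`. -/
def modelPosterior (X : Matrix (Fin n) (Fin p) ℝ) (S : Finset (Fin p))
    (y : EuclideanSpace ℝ (Fin n)) : ℝ≥0∞ :=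
  modelPrior h X S * unnormPosterior h X S y Set.univ /
    ∑ T : Finset (Fin p), modelPrior h X T * unnormPosterior h X T y Set.univ

/-- Conditional posterior predictive law given `S` of a new response
`ỹ | β_S, σ² ∼ N_d(X̃_S β_S, σ² I_d)`. -/
def condPredictive (X : Matrix (Fin n) (Fin p) ℝ) (Xt : Matrix (Fin d) (Fin p) ℝ)
    (S : Finset (Fin p)) (y : EuclideanSpace ℝ (Fin n)) : Measure (EuclideanSpace ℝ (Fin d)) :=
  (condPosterior h X S y).bind fun θ =>
    multivariateGaussian (fit Xt S θ.1) (θ.2 • (1 : Matrix (Fin d) (Fin d) ℝ))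

/-- Posterior predictive law of the new response, averaged over the models. -/
def predictive (X : Matrix (Fin n) (Fin p) ℝ) (Xt : Matrix (Fin d) (Fin p) ℝ)
    (y : EuclideanSpace ℝ (Fin n)) : Measure (EuclideanSpace ℝ (Fin d)) :=
  ∑ S : Finset (Fin p), modelPosterior h X S y • condPredictive h X Xt S y

/-- The normal law
`N_d(X̃_S lse, σ₀² [I_d + (α + γ)⁻¹ X̃_S (X_Sᵀ X_S)⁻¹ X̃_Sᵀ])`. -/
def normalPredictive (X : Matrix (Fin n) (Fin p) ℝ) (Xt : Matrix (Fin d) (Fin p) ℝ)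
    (sigma0 : ℝ) (S : Finset (Fin p)) (y : EuclideanSpace ℝ (Fin n)) :
    Measure (EuclideanSpace ℝ (Fin d)) :=
  multivariateGaussian (fit Xt S (lse X S y))
    (sigma0 ^ 2 • ((1 : Matrix (Fin d) (Fin d) ℝ) +
      (h.alpha + h.gamma)⁻¹ • (cols Xt S * (gram X S)⁻¹ * (cols Xt S)ᵀ)))

end Bayes

end EmpPrior

end

/-! Conjugacy makes everything explicit for a fixed model. Write the precision as g = 1/σ² and
standardize the coefficient vector. The prior given S is then the image of a product of a gamma law
and a standard Gaussian law. The fractional likelihood factors in these coordinates into a function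
of g and a centred Gaussian tilt (`unnormPosterior_eq`), because the prior is centred at the least
squares estimator. So g has a gamma posterior with shape a₀ + nα/2 and rate b₀ + (α/2)·RSS, and the
prior factor 1/γ becomes 1/(α+γ). Integrating out the coefficients shows that the conditional
predictive law is a mixture over g of N(m, g⁻¹Σ), where m and Σ are the centre and the shape matrix
of the limiting normal law (`condPredictive_eq`).

The distance to that normal law splits in two. Replacing the model average by its component at the
true support costs at most 1 - πⁿ(S*) in total variation, which selection consistency controls. For
that component, only the scales g⁻¹ and σ₀² differ. The distance between N(m, vΣ) and N(m, wΣ) is at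
most 1 - min(v/w, w/v)^(d/2), whatever Σ is (`abs_multivariateGaussian_real_sub_le`). With d fixed,
it remains to see that g⁻¹/σ₀² concentrates at 1.

The gamma law has relative variance 1/shape = O(1/n), so g is close to shape/rate. Under the truth,
RSS = σ₀²(‖z‖² - zᵀHz) with z standard Gaussian and H the projection on the true columns. The mean
of |‖z‖² - n| is O(√n) and the mean of zᵀHz is |S*|, at most √n eventually by sparsity, so
rate/(shape·σ₀²) is within O(n^(-1/2)) of 1 in mean (`lintegral_postRate_le`). The bounds do not
involve p, the designs or β beyond |S*| and the selection probability, hence uniformity. Finally, H²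
≤ 2·TV transfers the result to the Hellinger distance. -/

noncomputable section

namespace EmpPrior

/-! ### Total variation, Hellinger distance and measurability of divergences -/

section Distances

variable {Ω : Type*} [MeasurableSpace Ω]

lemma tvDist_comm (P Q : Measure Ω) : tvDist P Q = tvDist Q P := by
  simp only [tvDist, abs_sub_comm]

lemma tvDist_triangle (P Q R : Measure Ω) : tvDist P R ≤ tvDist P Q + tvDist Q R := by
  refine iSup₂_le fun A hA => ?_
  calc ENNReal.ofReal |P.real A - R.real A|
      ≤ ENNReal.ofReal (|P.real A - Q.real A| + |Q.real A - R.real A|) :=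
        ENNReal.ofReal_le_ofReal (abs_sub_le _ _ _)
    _ = ENNReal.ofReal |P.real A - Q.real A| + ENNReal.ofReal |Q.real A - R.real A| :=
        ENNReal.ofReal_add (abs_nonneg _) (abs_nonneg _)
    _ ≤ _ := add_le_add
        (le_iSup₂ (f := fun (A : Set Ω) (_ : MeasurableSet A) =>
          ENNReal.ofReal |P.real A - Q.real A|) A hA)
        (le_iSup₂ (f := fun (A : Set Ω) (_ : MeasurableSet A) =>
          ENNReal.ofReal |Q.real A - R.real A|) A hA)

/-- If `c • Q ≤ P` for probability measures, then `P` and `Q` are within `1 - c` in total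
variation. -/
lemma abs_measureReal_sub_le_of_smul_le {P Q : Measure Ω} [IsProbabilityMeasure P]
    [IsProbabilityMeasure Q] {c : ℝ≥0∞} (hc : c ≤ 1) (h : c • Q ≤ P) {A : Set Ω}
    (hA : MeasurableSet A) : |P.real A - Q.real A| ≤ 1 - c.toReal := by
  have key : ∀ B : Set Ω, c.toReal * Q.real B ≤ P.real B := fun B => by
    have := ENNReal.toReal_mono (measure_ne_top P B) (h B)
    simpa [Measure.real] using this
  have hc0 : 0 ≤ c.toReal := ENNReal.toReal_nonneg
  have hc1 : c.toReal ≤ 1 := ENNReal.toReal_le_of_le_ofReal zero_le_one (by simpa using hc)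
  have h1 := key A
  -- The domination is one-sided: on A it bounds Q - P by (1 - c)·Q(A), and on the complement it
  -- bounds P - Q.
  have h2 := key Aᶜ
  rw [probReal_compl_eq_one_sub hA, probReal_compl_eq_one_sub hA] at h2
  have h3 : Q.real A ≤ 1 := measureReal_le_one
  have h4 : 0 ≤ Q.real A := measureReal_nonneg
  rw [abs_le]
  constructor <;> nlinarith

lemma tvDist_le_of_smul_le {P Q : Measure Ω} [IsProbabilityMeasure P]
    [IsProbabilityMeasure Q] {c : ℝ≥0∞} (hc : c ≤ 1) (h : c • Q ≤ P) :
    tvDist P Q ≤ 1 - c := by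
  refine iSup₂_le fun A hA => ?_
  have hct : c ≠ ∞ := ne_top_of_le_ne_top ENNReal.one_ne_top hc
  refine (ENNReal.ofReal_le_ofReal (abs_measureReal_sub_le_of_smul_le hc h hA)).trans ?_
  rw [ENNReal.ofReal_sub _ ENNReal.toReal_nonneg, ENNReal.ofReal_one, ENNReal.ofReal_toReal hct]

lemma setLIntegral_rnDeriv_add_left (P Q : Measure Ω) [IsFiniteMeasure P] [IsFiniteMeasure Q]
    (A : Set Ω) : ∫⁻ x in A, P.rnDeriv (P + Q) x ∂(P + Q) = P A :=
  Measure.setLIntegral_rnDeriv (Measure.le_add_right le_rfl).absolutelyContinuous A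

lemma setLIntegral_rnDeriv_add_right (P Q : Measure Ω) [IsFiniteMeasure P] [IsFiniteMeasure Q]
    (A : Set Ω) : ∫⁻ x in A, Q.rnDeriv (P + Q) x ∂(P + Q) = Q A :=
  Measure.setLIntegral_rnDeriv (Measure.le_add_left le_rfl).absolutelyContinuous A

lemma measure_tsub_le_lintegral_rnDeriv_tsub (P Q : Measure Ω) [IsFiniteMeasure P]
    [IsFiniteMeasure Q] (A : Set Ω) :
    P A - Q A ≤ ∫⁻ x, (P.rnDeriv (P + Q) x - Q.rnDeriv (P + Q) x) ∂(P + Q) := by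
  rw [← setLIntegral_rnDeriv_add_left P Q A, ← setLIntegral_rnDeriv_add_right P Q A]
  exact (lintegral_sub_le _ _ (Measure.measurable_rnDeriv _ _)).trans (setLIntegral_le_lintegral _ _)

/-- The total variation distance in terms of densities. -/
lemma tvDist_eq_lintegral (P Q : Measure Ω) [IsProbabilityMeasure P] [IsProbabilityMeasure Q] :
    tvDist P Q = ∫⁻ x, (P.rnDeriv (P + Q) x - Q.rnDeriv (P + Q) x) ∂(P + Q) := by
  have hreal : ∀ A : Set Ω, ENNReal.ofReal (P.real A - Q.real A) = P A - Q A := fun A => by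
    rw [ENNReal.ofReal_sub _ measureReal_nonneg, ofReal_measureReal, ofReal_measureReal]
  refine le_antisymm (iSup₂_le fun A hA => ?_) ?_
  · rcases le_total (Q.real A) (P.real A) with h | h
    · rw [abs_of_nonneg (sub_nonneg.2 h), hreal]
      exact measure_tsub_le_lintegral_rnDeriv_tsub P Q A
    -- When Q exceeds P on A, P exceeds Q by the same amount on the complement, so one truncated
    -- difference handles both signs.
    · have : |P.real A - Q.real A| = P.real Aᶜ - Q.real Aᶜ := by
        rw [abs_of_nonpos (sub_nonpos.2 h), probReal_compl_eq_one_sub hA,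
          probReal_compl_eq_one_sub hA]
        ring
      rw [this, hreal]
      exact measure_tsub_le_lintegral_rnDeriv_tsub P Q Aᶜ
  -- The supremum is attained at the set where the density of P is the larger one.
  · set A := {x | Q.rnDeriv (P + Q) x < P.rnDeriv (P + Q) x} with hAdef
    have hA : MeasurableSet A :=
      measurableSet_lt (Measure.measurable_rnDeriv _ _) (Measure.measurable_rnDeriv _ _)
    have h1 : ∫⁻ x, (P.rnDeriv (P + Q) x - Q.rnDeriv (P + Q) x) ∂(P + Q)
        = ∫⁻ x in A, (P.rnDeriv (P + Q) x - Q.rnDeriv (P + Q) x) ∂(P + Q) := by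
      rw [← lintegral_indicator hA]
      refine lintegral_congr fun x => ?_
      by_cases hx : x ∈ A
      · rw [Set.indicator_of_mem hx]
      · rw [Set.indicator_of_notMem hx]
        exact tsub_eq_zero_of_le (not_lt.1 hx)
    rw [h1, lintegral_sub (Measure.measurable_rnDeriv _ _), setLIntegral_rnDeriv_add_left,
      setLIntegral_rnDeriv_add_right, ← hreal]
    · exact (ENNReal.ofReal_le_ofReal (le_abs_self _)).trans
        (le_iSup₂ (f := fun (A : Set Ω) (_ : MeasurableSet A) =>
          ENNReal.ofReal |P.real A - Q.real A|) A hA)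
    · rw [setLIntegral_rnDeriv_add_right]
      exact measure_ne_top _ _
    · exact (ae_restrict_iff' hA).2 (Eventually.of_forall fun x hx => hx.le)

lemma sq_sqrt_sub_sqrt_le (a b : ℝ) (ha : 0 ≤ a) (hb : 0 ≤ b) : (√a - √b) ^ 2 ≤ |a - b| := by
  have h : |a - b| = |√a - √b| * (√a + √b) := by
    rw [← abs_of_nonneg (add_nonneg (Real.sqrt_nonneg a) (Real.sqrt_nonneg b)), ← abs_mul]
    congr 1
    nlinarith [Real.sq_sqrt ha, Real.sq_sqrt hb]
  rw [h, ← sq_abs, sq]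
  refine mul_le_mul_of_nonneg_left ?_ (abs_nonneg _)
  rw [abs_le]
  constructor <;> linarith [Real.sqrt_nonneg a, Real.sqrt_nonneg b]

/-- Pointwise (√p - √q)² ≤ |p - q|, and |p - q| is the sum of the two truncated differences, each of
which integrates to the total variation distance. -/
lemma hellingerSq_le_two_mul_tvDist (P Q : Measure Ω) [IsProbabilityMeasure P]
    [IsProbabilityMeasure Q] : hellingerSq P Q ≤ 2 * tvDist P Q := by
  have h2 : 2 * tvDist P Q = ∫⁻ x, ((P.rnDeriv (P + Q) x - Q.rnDeriv (P + Q) x)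
      + (Q.rnDeriv (P + Q) x - P.rnDeriv (P + Q) x)) ∂(P + Q) := by
    rw [lintegral_add_left (f := fun x => P.rnDeriv (P + Q) x - Q.rnDeriv (P + Q) x)
      ((Measure.measurable_rnDeriv _ _).sub (Measure.measurable_rnDeriv _ _)), two_mul]
    congr 1
    · exact tvDist_eq_lintegral P Q
    · rw [tvDist_comm, tvDist_eq_lintegral, add_comm Q P]
  rw [h2, hellingerSq]
  refine lintegral_mono_ae ?_
  filter_upwards [Measure.rnDeriv_ne_top P (P + Q), Measure.rnDeriv_ne_top Q (P + Q)] with x hp hq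
  refine (ENNReal.ofReal_le_ofReal (sq_sqrt_sub_sqrt_le _ _ ENNReal.toReal_nonneg
    ENNReal.toReal_nonneg)).trans ?_
  rcases le_total (Q.rnDeriv (P + Q) x) (P.rnDeriv (P + Q) x) with h | h
  · rw [abs_of_nonneg (sub_nonneg.2 (ENNReal.toReal_mono hp h)),
      ← ENNReal.toReal_sub_of_le h hp, ENNReal.ofReal_toReal (ENNReal.sub_ne_top hp)]
    exact le_self_add
  · rw [abs_of_nonpos (sub_nonpos.2 (ENNReal.toReal_mono hq h)), neg_sub,
      ← ENNReal.toReal_sub_of_le h hq, ENNReal.ofReal_toReal (ENNReal.sub_ne_top hq)]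
    exact le_add_self

variable {Y : Type*} [MeasurableSpace Y] [MeasurableSpace.CountableOrCountablyGenerated Y Ω]

/-- A divergence computed from densities depends measurably on a parameter of the two measures. -/
lemma measurable_lintegral_rnDeriv {P Q : Y → Measure Ω} (hP : Measurable P) (hQ : Measurable Q)
    [∀ y, IsProbabilityMeasure (P y)] [∀ y, IsProbabilityMeasure (Q y)]
    {F : ℝ≥0∞ × ℝ≥0∞ → ℝ≥0∞} (hF : Measurable F) :
    Measurable fun y => ∫⁻ x, F ((P y).rnDeriv (P y + Q y) x, (Q y).rnDeriv (P y + Q y) x)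
      ∂(P y + Q y) := by
  -- Densities chosen separately for each y need not be jointly measurable. The kernel density is,
  -- and it agrees almost everywhere with the pointwise one.
  let κ : Kernel Y Ω := ⟨P, hP⟩
  let η : Kernel Y Ω := ⟨Q, hQ⟩
  have : IsMarkovKernel κ := ⟨fun y => inferInstanceAs (IsProbabilityMeasure (P y))⟩
  have : IsMarkovKernel η := ⟨fun y => inferInstanceAs (IsProbabilityMeasure (Q y))⟩
  have heq : (fun y => ∫⁻ x, F ((P y).rnDeriv (P y + Q y) x, (Q y).rnDeriv (P y + Q y) x)
      ∂(P y + Q y)) = fun y => ∫⁻ x, F (Kernel.rnDeriv κ (κ + η) y x,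
        Kernel.rnDeriv η (κ + η) y x) ∂((κ + η) y) := by
    funext y
    refine lintegral_congr_ae ?_
    filter_upwards [Kernel.rnDeriv_eq_rnDeriv_measure (κ := κ) (η := κ + η) (a := y),
      Kernel.rnDeriv_eq_rnDeriv_measure (κ := η) (η := κ + η) (a := y)] with x h1 h2
    rw [h1, h2]
    rfl
  rw [heq]
  exact Measurable.lintegral_kernel_prod_right'
    (f := fun q : Y × Ω => F (Kernel.rnDeriv κ (κ + η) q.1 q.2, Kernel.rnDeriv η (κ + η) q.1 q.2))
    (hF.comp ((Kernel.measurable_rnDeriv κ (κ + η)).prodMk (Kernel.measurable_rnDeriv η (κ + η))))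

lemma measurable_hellingerSq {P Q : Y → Measure Ω} (hP : Measurable P) (hQ : Measurable Q)
    [∀ y, IsProbabilityMeasure (P y)] [∀ y, IsProbabilityMeasure (Q y)] :
    Measurable fun y => hellingerSq (P y) (Q y) :=
  measurable_lintegral_rnDeriv hP hQ
    (F := fun q => ENNReal.ofReal ((√q.1.toReal - √q.2.toReal) ^ 2)) (by fun_prop)

lemma measurable_tvDist {P Q : Y → Measure Ω} (hP : Measurable P) (hQ : Measurable Q)
    [∀ y, IsProbabilityMeasure (P y)] [∀ y, IsProbabilityMeasure (Q y)] :
    Measurable fun y => tvDist (P y) (Q y) := by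
  simp_rw [tvDist_eq_lintegral]
  exact measurable_lintegral_rnDeriv hP hQ (F := fun q => q.1 - q.2)
    (measurable_fst.sub measurable_snd)

/-- Mixtures are jointly convex in total variation, against a fixed second argument. -/
lemma tvDist_bind_le {Θ : Type*} [MeasurableSpace Θ] (μ : Measure Θ) [IsProbabilityMeasure μ]
    {κ : Θ → Measure Ω} (hκ : AEMeasurable κ μ) (hprob : ∀ θ, IsProbabilityMeasure (κ θ))
    (Q : Measure Ω) [IsProbabilityMeasure Q] {φ : Θ → ℝ}
    (hφ : ∀ᵐ θ ∂μ, ∀ A, MeasurableSet A → |(κ θ).real A - Q.real A| ≤ φ θ) :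
    tvDist (μ.bind κ) Q ≤ ∫⁻ θ, ENNReal.ofReal (φ θ) ∂μ := by
  refine iSup₂_le fun A hA => ?_
  have hmeas : AEMeasurable (fun θ => κ θ A) μ :=
    (Measure.measurable_coe hA).comp_aemeasurable hκ
  have hint : Integrable (fun θ => (κ θ).real A) μ := by
    refine Integrable.of_bound hmeas.ennreal_toReal.aestronglyMeasurable 1
      (Eventually.of_forall fun θ => ?_)
    have := hprob θ
    rw [Real.norm_of_nonneg measureReal_nonneg]
    exact measureReal_le_one
  have h1 : (μ.bind κ).real A = ∫ θ, (κ θ).real A ∂μ := by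
    rw [Measure.real, Measure.bind_apply hA hκ, ← integral_toReal hmeas]
    · rfl
    · exact Eventually.of_forall fun θ => by have := hprob θ; exact measure_lt_top _ _
  have h2 : (μ.bind κ).real A - Q.real A = ∫ θ, ((κ θ).real A - Q.real A) ∂μ := by
    rw [integral_sub hint (integrable_const _), h1]
    simp
  rw [h2, ← Real.norm_eq_abs, ofReal_norm]
  refine (enorm_integral_le_lintegral_enorm _).trans (lintegral_mono_ae ?_)
  filter_upwards [hφ] with θ h
  rw [← ofReal_norm]
  exact ENNReal.ofReal_le_ofReal (h A hA)

/-- The image of a fixed measure under a jointly measurable map depends measurably on the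
parameter. -/
lemma measurable_map_param {Z W Y : Type*} [MeasurableSpace Z] [MeasurableSpace W]
    [MeasurableSpace Y] (μ : Measure Z) [SFinite μ] {F : Y → Z → W}
    (hF : Measurable (Function.uncurry F)) : Measurable fun y => μ.map (F y) := by
  refine Measure.measurable_of_measurable_coe _ fun A hA => ?_
  have : (fun y => μ.map (F y) A) = fun y => μ (Prod.mk y ⁻¹' (Function.uncurry F ⁻¹' A)) := by
    funext y
    rw [Measure.map_apply hF.of_uncurry_left hA]
    rfl
  rw [this]
  exact measurable_measure_prodMk_left (hF hA)

end Distances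

/-! ### Gaussian laws: exponential tilts, scale comparison, mixtures over the mean -/

section Gaussian

/-- Lifts a one-dimensional tilt to product measures: on boxes the integral of the product factors
by independence. Finiteness of c keeps the scaled factors finite, so that boxes determine the
product. -/
lemma pi_withDensity_prod {ι : Type*} [Fintype ι] {E : Type*} [MeasurableSpace E]
    (μ : Measure E) [IsProbabilityMeasure μ] {f : E → ℝ≥0∞} (hf : Measurable f)
    {c : ℝ≥0∞} (hc : c ≠ ∞) {ν : Measure E} [IsProbabilityMeasure ν]
    (h : μ.withDensity f = c • ν) :
    (Measure.pi fun _ : ι => μ).withDensity (fun x => ∏ i, f (x i))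
      = c ^ Fintype.card ι • Measure.pi fun _ : ι => ν := by
  have : IsFiniteMeasure (c • ν) := ⟨by
    simpa [Measure.smul_apply] using hc.lt_top⟩
  have key : ∀ s : Set E, MeasurableSet s → ∫⁻ x, s.indicator f x ∂μ = (c • ν) s := fun s hs => by
    rw [lintegral_indicator hs, ← h, withDensity_apply _ hs]
  have e1 : (Measure.pi fun _ : ι => c • ν)
      = (Measure.pi fun _ : ι => μ).withDensity (fun x => ∏ i, f (x i)) := by
    refine Measure.pi_eq fun s hs => ?_
    rw [withDensity_apply _ (MeasurableSet.univ_pi hs), ← lintegral_indicator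
      (MeasurableSet.univ_pi hs)]
    have : (Set.univ.pi s).indicator (fun x : ι → E => ∏ i, f (x i))
        = fun x => ∏ i, ((s i).indicator f (x i)) := by
      funext x
      by_cases hx : x ∈ Set.univ.pi s
      · rw [Set.indicator_of_mem hx]
        exact Finset.prod_congr rfl fun i _ => by
          rw [Set.indicator_of_mem (hx i (Set.mem_univ i))]
      · rw [Set.indicator_of_notMem hx]
        simp only [Set.mem_pi, Set.mem_univ, true_imp_iff, not_forall] at hx
        obtain ⟨i, hi⟩ := hx
        exact (Finset.prod_eq_zero (Finset.mem_univ i) (Set.indicator_of_notMem hi f)).symm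
    rw [this]
    have hind := iIndepFun_pi (μ := fun _ : ι => μ) (X := fun i => (s i).indicator f)
      (fun i => (hf.indicator (hs i)).aemeasurable)
    have := lintegral_prod_eq_prod_lintegral_of_indepFun Finset.univ
      (fun i (x : ι → E) => (s i).indicator f (x i)) hind
      (fun i => (hf.indicator (hs i)).comp (measurable_pi_apply i))
    rw [this]
    refine Finset.prod_congr rfl fun i _ => ?_
    rw [← key (s i) (hs i)]
    exact (measurePreserving_eval (fun _ : ι => μ) i).lintegral_comp (hf.indicator (hs i))
  rw [← e1]
  refine Measure.pi_eq fun s hs => ?_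
  rw [Measure.smul_apply, Measure.pi_pi]
  simp [Finset.prod_mul_distrib]

lemma gaussianReal_withDensity_exp {τ : ℝ} (hτ : 0 ≤ τ) :
    (gaussianReal 0 1).withDensity (fun x => ENNReal.ofReal (Real.exp (-(τ / 2) * x ^ 2)))
      = ENNReal.ofReal (√(1 + τ))⁻¹ • (gaussianReal 0 1).map ((√(1 + τ))⁻¹ * ·) := by
  have h1 : 0 < 1 + τ := by linarith
  have hs : 0 < √(1 + τ) := Real.sqrt_pos.2 h1
  rw [gaussianReal_map_const_mul, mul_zero, mul_one, gaussianReal_of_var_ne_zero _ one_ne_zero,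
    gaussianReal_of_var_ne_zero]
  · rw [← withDensity_mul _ (measurable_gaussianPDF 0 1) (by fun_prop),
      ← withDensity_smul _ (measurable_gaussianPDF _ _)]
    congr 1
    funext x
    simp only [Pi.mul_apply, Pi.smul_apply, smul_eq_mul, gaussianPDF]
    rw [← ENNReal.ofReal_mul (gaussianPDFReal_nonneg _ _ _),
      ← ENNReal.ofReal_mul (by positivity)]
    congr 1
    simp only [gaussianPDFReal, NNReal.coe_one, NNReal.coe_mk]
    rw [mul_assoc, ← Real.exp_add, ← mul_assoc]
    congr 1
    · have : √(2 * Real.pi * (√(1 + τ))⁻¹ ^ 2) = √(2 * Real.pi) * (√(1 + τ))⁻¹ := by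
        rw [Real.sqrt_mul (by positivity), Real.sqrt_sq (by positivity)]
      rw [mul_one, this, mul_inv, inv_inv]
      field_simp
    · congr 1
      rw [inv_pow, Real.sq_sqrt h1.le]
      field_simp
      ring
  · rw [Ne, ← NNReal.coe_eq_zero]
    simp only [NNReal.coe_mk]
    positivity

lemma withDensity_map {E F : Type*} [MeasurableSpace E] [MeasurableSpace F] (μ : Measure E)
    {Φ : E → F} (hΦ : Measurable Φ) {f : F → ℝ≥0∞} (hf : Measurable f) :
    (μ.map Φ).withDensity f = (μ.withDensity fun x => f (Φ x)).map Φ := by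
  ext A hA
  rw [withDensity_apply _ hA, Measure.map_apply hΦ hA, withDensity_apply _ (hΦ hA),
    setLIntegral_map hA hf hΦ]

/-- The tilt raises the precision from 1 to 1 + τ in each coordinate. It serves twice: to compare
two Gaussian scales, and to update the coefficients by the likelihood. -/
lemma stdGaussian_withDensity_exp (ι : Type*) [Fintype ι] {τ : ℝ} (hτ : 0 ≤ τ) :
    (stdGaussian (EuclideanSpace ℝ ι)).withDensity
        (fun z => ENNReal.ofReal (Real.exp (-(τ / 2) * ‖z‖ ^ 2)))
      = ENNReal.ofReal (√(1 + τ))⁻¹ ^ Fintype.card ι •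
        (stdGaussian (EuclideanSpace ℝ ι)).map ((√(1 + τ))⁻¹ • ·) := by
  have : IsProbabilityMeasure ((gaussianReal 0 1).map ((√(1 + τ))⁻¹ * ·)) :=
    Measure.isProbabilityMeasure_map (by fun_prop)
  have hpi := pi_withDensity_prod (ι := ι) (gaussianReal 0 1)
    (f := fun x => ENNReal.ofReal (Real.exp (-(τ / 2) * x ^ 2))) (by fun_prop)
    ENNReal.ofReal_ne_top (gaussianReal_withDensity_exp hτ)
  rw [← map_pi_eq_stdGaussian]
  have hprod : ∀ x : ι → ℝ, ENNReal.ofReal (Real.exp (-(τ / 2) * ‖WithLp.toLp 2 x‖ ^ 2))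
      = ∏ i, ENNReal.ofReal (Real.exp (-(τ / 2) * x i ^ 2)) := fun x => by
    rw [← ENNReal.ofReal_prod_of_nonneg (fun i _ => (Real.exp_pos _).le), ← Real.exp_sum,
      ← Finset.mul_sum, EuclideanSpace.real_norm_sq_eq]
  have hmapd : (((Measure.pi fun _ : ι => gaussianReal 0 1)).map (WithLp.toLp 2)).withDensity
        (fun z : EuclideanSpace ℝ ι => ENNReal.ofReal (Real.exp (-(τ / 2) * ‖z‖ ^ 2)))
      = ((Measure.pi fun _ : ι => gaussianReal 0 1).withDensity
        (fun x => ∏ i, ENNReal.ofReal (Real.exp (-(τ / 2) * x i ^ 2)))).map (WithLp.toLp 2) := by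
    rw [withDensity_map _ (by fun_prop) (by fun_prop)]
    simp_rw [hprod]
  rw [hmapd, hpi, Measure.map_smul, ← Measure.pi_map_pi (fun i => by fun_prop),
    Measure.map_map (by fun_prop) (by fun_prop), Measure.map_map (by fun_prop) (by fun_prop)]
  rfl

variable {ι κ : Type*} [Fintype ι] [Fintype κ] [DecidableEq κ]

/-- Left multiplication by a matrix as a continuous linear map of Euclidean spaces. -/
def mulVecOp (M : Matrix ι κ ℝ) : EuclideanSpace ℝ κ →L[ℝ] EuclideanSpace ℝ ι :=
  LinearMap.toContinuousLinearMap (Matrix.toLpLin 2 2 M)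

lemma mulVecOp_apply (M : Matrix ι κ ℝ) (z : EuclideanSpace ℝ κ) :
    mulVecOp M z = WithLp.toLp 2 (M *ᵥ z.ofLp) := rfl

variable [DecidableEq ι]

/-- The nonnegative square root of a matrix as an operator on the Euclidean space. -/
def sqrtOp (S : Matrix ι ι ℝ) : EuclideanSpace ℝ ι →L[ℝ] EuclideanSpace ℝ ι :=
  open scoped MatrixOrder Matrix.Norms.L2Operator in
  Matrix.toEuclideanCLM (𝕜 := ℝ) (CFC.sqrt S)

lemma multivariateGaussian_eq_map (m : EuclideanSpace ℝ ι) (S : Matrix ι ι ℝ) :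
    multivariateGaussian m S
      = (stdGaussian (EuclideanSpace ℝ ι)).map (fun z => m + sqrtOp S z) := rfl

open scoped MatrixOrder Matrix.Norms.L2Operator in
lemma sqrtOp_smul {S : Matrix ι ι ℝ} (hS : S.PosSemidef) {v : ℝ} (hv : 0 ≤ v) :
    sqrtOp (v • S) = √v • sqrtOp S := by
  have : CFC.sqrt (v • S) = √v • CFC.sqrt S := by
    refine CFC.sqrt_unique ?_ (smul_nonneg (Real.sqrt_nonneg v) (CFC.sqrt_nonneg S))
    rw [smul_mul_smul_comm, Real.mul_self_sqrt hv, CFC.sqrt_mul_sqrt_self S hS.nonneg]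
  rw [sqrtOp, sqrtOp, this, map_smul]

open scoped MatrixOrder Matrix.Norms.L2Operator in
lemma sqrtOp_one : sqrtOp (1 : Matrix ι ι ℝ) = 1 := by
  rw [sqrtOp, CFC.sqrt_one, map_one]

open scoped MatrixOrder Matrix.Norms.L2Operator in
lemma exists_sqrtOp_eq {S : Matrix ι ι ℝ} (hS : S.PosSemidef) :
    ∃ A : Matrix ι ι ℝ, Aᵀ = A ∧ A * A = S ∧ sqrtOp S = mulVecOp A := by
  refine ⟨CFC.sqrt S, ?_, CFC.sqrt_mul_sqrt_self S hS.nonneg, ?_⟩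
  · have := (CFC.sqrt_nonneg S).isSelfAdjoint
    simpa [IsSelfAdjoint, Matrix.star_eq_conjTranspose] using this
  · rfl

lemma multivariateGaussian_smul_eq_map (m : EuclideanSpace ℝ ι) {S : Matrix ι ι ℝ}
    (hS : S.PosSemidef) {v : ℝ} (hv : 0 ≤ v) :
    multivariateGaussian m (v • S)
      = (stdGaussian (EuclideanSpace ℝ ι)).map (fun z => m + √v • sqrtOp S z) := by
  rw [multivariateGaussian_eq_map, sqrtOp_smul hS hv]
  rfl

/-- A Gaussian law with the smaller covariance is dominated by the one with the larger
covariance, up to a factor. -/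
lemma smul_multivariateGaussian_le (m : EuclideanSpace ℝ ι) {S : Matrix ι ι ℝ}
    (hS : S.PosSemidef) {v w : ℝ} (hv : 0 < v) (hvw : v ≤ w) :
    ENNReal.ofReal (√(v / w)) ^ Fintype.card ι • multivariateGaussian m (v • S)
      ≤ multivariateGaussian m (w • S) := by
  have hw : 0 < w := hv.trans_le hvw
  -- With 1 + τ = w/v the tilt shrinks the standard Gaussian by √(v/w). Its density is at most 1,
  -- which gives the domination before the affine map is applied. Since no density of the image is
  -- used, a singular S is allowed.
  have hτ : 0 ≤ w / v - 1 := by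
    rw [sub_nonneg, one_le_div hv]; exact hvw
  have h1 : (√(1 + (w / v - 1)))⁻¹ = √(v / w) := by
    rw [← Real.sqrt_inv, add_sub_cancel, inv_div]
  have hle : ENNReal.ofReal (√(v / w)) ^ Fintype.card ι •
      (stdGaussian (EuclideanSpace ℝ ι)).map (√(v / w) • ·) ≤ stdGaussian (EuclideanSpace ℝ ι) := by
    rw [← h1, ← stdGaussian_withDensity_exp ι hτ]
    conv_rhs => rw [← withDensity_one (μ := stdGaussian (EuclideanSpace ℝ ι))]
    refine withDensity_mono (Eventually.of_forall fun z => ?_)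
    rw [Pi.one_apply, ← ENNReal.ofReal_one]
    refine ENNReal.ofReal_le_ofReal (Real.exp_le_one_iff.2 ?_)
    have := mul_nonneg (half_pos (zero_lt_one)).le (mul_nonneg hτ (sq_nonneg ‖z‖))
    linarith
  rw [multivariateGaussian_smul_eq_map m hS hv.le, multivariateGaussian_smul_eq_map m hS hw.le]
  have hmeas : Measurable fun z : EuclideanSpace ℝ ι => m + √w • sqrtOp S z := by fun_prop
  refine le_trans (le_of_eq ?_) (Measure.map_mono hle hmeas)
  rw [Measure.map_smul, Measure.map_map hmeas (by fun_prop)]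
  congr 2
  funext z
  simp only [Function.comp, map_smul, smul_smul]
  rw [← Real.sqrt_mul hw.le, mul_div_cancel₀ _ hw.ne']

lemma abs_multivariateGaussian_real_sub_le (m : EuclideanSpace ℝ ι) {S : Matrix ι ι ℝ}
    (hS : S.PosSemidef) {v w : ℝ} (hv : 0 < v) (hw : 0 < w) {A : Set (EuclideanSpace ℝ ι)}
    (hA : MeasurableSet A) :
    |(multivariateGaussian m (v • S)).real A - (multivariateGaussian m (w • S)).real A|
      ≤ 1 - √(min (v / w) (w / v)) ^ Fintype.card ι := by
  have aux : ∀ v w : ℝ, 0 < v → v ≤ w →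
      |(multivariateGaussian m (w • S)).real A - (multivariateGaussian m (v • S)).real A|
        ≤ 1 - √(v / w) ^ Fintype.card ι := fun v w hv hvw => by
    have hle : √(v / w) ≤ 1 := by
      rw [Real.sqrt_le_one]
      exact div_le_one_of_le₀ hvw (hv.le.trans hvw)
    have := abs_measureReal_sub_le_of_smul_le (c := ENNReal.ofReal (√(v / w)) ^ Fintype.card ι)
      (pow_le_one₀ zero_le (by simpa using hle))
      (smul_multivariateGaussian_le m hS hv hvw) hA
    rwa [ENNReal.toReal_pow, ENNReal.toReal_ofReal (Real.sqrt_nonneg _)] at this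
  rcases le_total v w with h | h
  · rw [abs_sub_comm, min_eq_left]
    · exact aux v w hv h
    · rw [div_le_div_iff₀ hw hv]; nlinarith
  · rw [min_eq_right]
    · exact aux w v hw h
    · rw [div_le_div_iff₀ hv hw]; nlinarith

lemma inner_mulVecOp (M : Matrix ι κ ℝ) (z : EuclideanSpace ℝ κ) (t : EuclideanSpace ℝ ι) :
    inner ℝ (mulVecOp M z) t = inner ℝ z (mulVecOp Mᵀ t) := by
  simp only [mulVecOp_apply, EuclideanSpace.inner_eq_star_dotProduct, star_trivial,
    Matrix.dotProduct_mulVec, Matrix.mulVec_transpose]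

lemma charFun_stdGaussian_map_mulVecOp (M : Matrix ι κ ℝ) (t : EuclideanSpace ℝ ι) :
    charFun ((stdGaussian (EuclideanSpace ℝ κ)).map (mulVecOp M)) t
      = Complex.exp (-(t ⬝ᵥ (M * Mᵀ) *ᵥ t : ℝ) / 2) := by
  rw [charFun_apply, integral_map (by fun_prop) (by fun_prop)]
  simp_rw [inner_mulVecOp]
  rw [← charFun_apply, charFun_stdGaussian, ← Complex.ofReal_pow, ← real_inner_self_eq_norm_sq,
    ← inner_mulVecOp, mulVecOp_apply, mulVecOp_apply, Matrix.mulVec_mulVec,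
    EuclideanSpace.inner_eq_star_dotProduct]
  simp

lemma measurable_multivariateGaussian {Y : Type*} [MeasurableSpace Y]
    {m : Y → EuclideanSpace ℝ ι} (hm : Measurable m) (S : Matrix ι ι ℝ) :
    Measurable fun y => multivariateGaussian (m y) S := by
  simp_rw [multivariateGaussian_eq_map]
  exact measurable_map_param _ (F := fun (y : Y) (x : EuclideanSpace ℝ ι) => m y + sqrtOp S x) (by
    unfold Function.uncurry; fun_prop)

/-- Averaging a normal law with spherical covariance over a normal mean. -/
lemma stdGaussian_bind_multivariateGaussian (m : EuclideanSpace ℝ ι) (M : Matrix ι κ ℝ) {v : ℝ}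
    (hv : 0 ≤ v) :
    (stdGaussian (EuclideanSpace ℝ κ)).bind (fun z =>
        multivariateGaussian (m + mulVecOp M z) (v • (1 : Matrix ι ι ℝ)))
      = multivariateGaussian m (v • (1 : Matrix ι ι ℝ) + M * Mᵀ) := by
  have hI : (v • (1 : Matrix ι ι ℝ)).PosSemidef := Matrix.PosSemidef.one.smul hv
  have hM : (M * Mᵀ).PosSemidef := by
    simpa using Matrix.posSemidef_self_mul_conjTranspose M
  have hmeas : Measurable fun z : EuclideanSpace ℝ κ =>
      multivariateGaussian (m + mulVecOp M z) (v • (1 : Matrix ι ι ℝ)) :=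
    measurable_multivariateGaussian (by fun_prop) _
  have hconv : (stdGaussian (EuclideanSpace ℝ κ)).bind (fun z =>
        multivariateGaussian (m + mulVecOp M z) (v • (1 : Matrix ι ι ℝ)))
      = ((stdGaussian (EuclideanSpace ℝ κ)).map (mulVecOp M)).conv
        (multivariateGaussian m (v • (1 : Matrix ι ι ℝ))) := by
    ext A hA
    have hadd : MeasurableSet ((fun q : EuclideanSpace ℝ ι × EuclideanSpace ℝ ι => q.1 + q.2) ⁻¹' A) :=
      measurableSet_preimage (by fun_prop) hA
    rw [Measure.bind_apply hA hmeas.aemeasurable, Measure.conv, Measure.map_apply (by fun_prop) hA,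
      Measure.prod_apply hadd, lintegral_map (measurable_measure_prodMk_left hadd) (by fun_prop)]
    refine lintegral_congr fun z => ?_
    rw [multivariateGaussian_eq_map, multivariateGaussian_eq_map, Measure.map_apply (by fun_prop) hA,
      Measure.map_apply (by fun_prop) (measurable_prodMk_left hadd)]
    congr 1
    ext x
    simp only [Set.mem_preimage]
    rw [add_assoc, add_left_comm]
  have : IsProbabilityMeasure ((stdGaussian (EuclideanSpace ℝ κ)).map (mulVecOp M)) :=
    Measure.isProbabilityMeasure_map (by fun_prop)
  rw [hconv]
  refine Measure.ext_of_charFun ?_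
  funext t
  rw [charFun_conv, charFun_multivariateGaussian (hI.add hM), charFun_multivariateGaussian hI,
    charFun_stdGaussian_map_mulVecOp, ← Complex.exp_add]
  congr 1
  rw [Matrix.add_mulVec, dotProduct_add]
  push_cast
  ring

end Gaussian

/-! ### Gamma laws: tilting, relative variance, dependence on the rate -/

section Gamma

lemma ae_pos_gammaMeasure (a b : ℝ) : ∀ᵐ g ∂gammaMeasure a b, 0 < g := by
  have hm : Measurable (gammaPDF a b) := by unfold gammaPDF; fun_prop
  rw [gammaMeasure, ae_withDensity_iff hm]
  filter_upwards [Measure.ae_ne volume (0 : ℝ)] with g hg h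
  by_contra hneg
  exact h (gammaPDF_of_neg (lt_of_le_of_ne (not_lt.1 hneg) hg))

/-- The normalizing constant of an exponentially tilted gamma law. -/
def gammaTilt (a b k r : ℝ) : ℝ :=
  b ^ a / Real.Gamma a * (Real.Gamma (a + k) / (b + r) ^ (a + k))

lemma gammaTilt_pos {a b k r : ℝ} (ha : 0 < a) (hb : 0 < b) (hk : 0 ≤ k) (hr : 0 ≤ r) :
    0 < gammaTilt a b k r := by
  have := Real.Gamma_pos_of_pos ha
  have := Real.Gamma_pos_of_pos (add_pos_of_pos_of_nonneg ha hk)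
  unfold gammaTilt
  positivity

/-- Conjugacy in the precision variable: the likelihood factor g^k e^(-rg) shifts shape and rate.
The case r = 0 also yields the moments. -/
lemma gammaMeasure_withDensity {a b k r : ℝ} (ha : 0 < a) (hb : 0 < b) (hk : 0 ≤ k) (hr : 0 ≤ r) :
    (gammaMeasure a b).withDensity (fun g => ENNReal.ofReal (g ^ k * Real.exp (-(r * g))))
      = ENNReal.ofReal (gammaTilt a b k r) • gammaMeasure (a + k) (b + r) := by
  have hm : ∀ a b, Measurable (gammaPDF a b) := fun a b => by unfold gammaPDF; fun_prop
  rw [gammaMeasure, gammaMeasure, ← withDensity_mul _ (hm a b) (by fun_prop),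
    ← withDensity_smul _ (hm _ _)]
  refine withDensity_congr_ae ?_
  filter_upwards [Measure.ae_ne volume (0 : ℝ)] with g hg
  simp only [Pi.mul_apply, Pi.smul_apply, smul_eq_mul]
  rcases lt_or_gt_of_ne hg with h | h
  · rw [gammaPDF_of_neg h, gammaPDF_of_neg h, zero_mul, mul_zero]
  · have h1 := Real.Gamma_pos_of_pos ha
    have h2 := Real.Gamma_pos_of_pos (add_pos_of_pos_of_nonneg ha hk)
    have h3 : 0 < (b + r) ^ (a + k) := Real.rpow_pos_of_pos (by linarith) _
    rw [gammaPDF_of_nonneg h.le, gammaPDF_of_nonneg h.le, ← ENNReal.ofReal_mul (by positivity),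
      ← ENNReal.ofReal_mul (gammaTilt_pos ha hb hk hr).le, gammaTilt]
    congr 1
    have e1 : g ^ (a + k - 1) = g ^ (a - 1) * g ^ k := by
      rw [← Real.rpow_add h]; ring_nf
    have e2 : Real.exp (-((b + r) * g)) = Real.exp (-(b * g)) * Real.exp (-(r * g)) := by
      rw [← Real.exp_add]; ring_nf
    rw [e1, e2]
    field_simp

lemma lintegral_rpow_gammaMeasure {a b k : ℝ} (ha : 0 < a) (hb : 0 < b) (hk : 0 ≤ k) :
    ∫⁻ g, ENNReal.ofReal (g ^ k) ∂gammaMeasure a b = ENNReal.ofReal (gammaTilt a b k 0) := by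
  have h := congrArg (fun μ : Measure ℝ => μ Set.univ)
    (gammaMeasure_withDensity ha hb hk (le_refl (0 : ℝ)))
  have := isProbabilityMeasure_gammaMeasure (add_pos_of_pos_of_nonneg ha hk) hb
  simpa using h

/-- The relative variance of a gamma law is the inverse of its shape. -/
lemma lintegral_sq_gammaMeasure {a b : ℝ} (ha : 0 < a) (hb : 0 < b) :
    ∫⁻ g, ENNReal.ofReal ((b / a * g - 1) ^ 2) ∂gammaMeasure a b = ENNReal.ofReal (1 / a) := by
  have := isProbabilityMeasure_gammaMeasure ha hb
  have hG := Real.Gamma_pos_of_pos ha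
  have t1 : gammaTilt a b 1 0 = a / b := by
    rw [gammaTilt, Real.Gamma_add_one ha.ne', add_zero, Real.rpow_add hb, Real.rpow_one]
    have : 0 < b ^ a := Real.rpow_pos_of_pos hb _
    field_simp
  have t2 : gammaTilt a b 2 0 = a * (a + 1) / b ^ 2 := by
    rw [gammaTilt, show a + 2 = a + 1 + 1 by ring, Real.Gamma_add_one (by positivity),
      Real.Gamma_add_one ha.ne', add_zero, Real.rpow_add hb, Real.rpow_add hb, Real.rpow_one]
    have : 0 < b ^ a := Real.rpow_pos_of_pos hb _
    field_simp
  have i1 := lintegral_rpow_gammaMeasure ha hb zero_le_one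
  have i2 := lintegral_rpow_gammaMeasure ha hb (zero_le_two)
  rw [t1] at i1
  rw [t2] at i2
  simp only [Real.rpow_one, Real.rpow_two] at i1 i2
  -- This is the mean of the cross term of the square. It is added to both sides so that all
  -- integrands stay nonnegative, then cancelled.
  have hfin : ENNReal.ofReal (2 * (b / a) * (a / b)) ≠ ∞ := ENNReal.ofReal_ne_top
  have key : (∫⁻ g, ENNReal.ofReal ((b / a * g - 1) ^ 2) ∂gammaMeasure a b)
      + ENNReal.ofReal (2 * (b / a) * (a / b))
      = ENNReal.ofReal (1 / a) + ENNReal.ofReal (2 * (b / a) * (a / b)) := by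
    rw [ENNReal.ofReal_mul (by positivity), ← i1,
      ← lintegral_const_mul _ (by fun_prop), ← lintegral_add_left (by fun_prop)]
    have : ∫⁻ g, (ENNReal.ofReal ((b / a * g - 1) ^ 2)
          + ENNReal.ofReal (2 * (b / a)) * ENNReal.ofReal g) ∂gammaMeasure a b
        = ∫⁻ g, (ENNReal.ofReal ((b / a) ^ 2) * ENNReal.ofReal (g ^ 2) + 1) ∂gammaMeasure a b := by
      refine lintegral_congr_ae ?_
      filter_upwards [ae_pos_gammaMeasure a b] with g hg
      rw [← ENNReal.ofReal_mul (by positivity), ← ENNReal.ofReal_add (by positivity) (by positivity),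
        ← ENNReal.ofReal_mul (by positivity), ← ENNReal.ofReal_one,
        ← ENNReal.ofReal_add (by positivity) (by positivity)]
      congr 1
      ring
    rw [this, lintegral_add_right _ measurable_const, lintegral_const_mul _ (by fun_prop), i2,
      lintegral_const_mul _ (by fun_prop), i1, lintegral_const, measure_univ, mul_one,
      ← ENNReal.ofReal_mul (by positivity), ← ENNReal.ofReal_mul (by positivity),
      ← ENNReal.ofReal_one, ← ENNReal.ofReal_add (by positivity) (by positivity),
      ← ENNReal.ofReal_add (by positivity) (by positivity)]
    congr 1
    field_simp
    ring
  exact (ENNReal.add_left_inj hfin).1 key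

lemma measurable_bind_gammaMeasure {Y W : Type*} [MeasurableSpace Y] [MeasurableSpace W] (a : ℝ)
    {b : Y → ℝ} (hb : Measurable b) {κ : Y × ℝ → Measure W} (hκ : Measurable κ) :
    Measurable fun y => (gammaMeasure a (b y)).bind fun g => κ (y, g) := by
  refine Measure.measurable_of_measurable_coe _ fun A hA => ?_
  have hpdf : Measurable fun q : Y × ℝ => gammaPDF a (b q.1) q.2 := by
    unfold gammaPDF gammaPDFReal
    refine ENNReal.measurable_ofReal.comp (Measurable.ite (measurableSet_le measurable_const
      measurable_snd) ?_ measurable_const)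
    fun_prop
  have : (fun y => ((gammaMeasure a (b y)).bind fun g => κ (y, g)) A)
      = fun y => ∫⁻ g, gammaPDF a (b y) g * κ (y, g) A := by
    funext y
    have hκy : Measurable fun g => κ (y, g) := hκ.comp measurable_prodMk_left
    rw [Measure.bind_apply hA hκy.aemeasurable, gammaMeasure,
      lintegral_withDensity_eq_lintegral_mul volume (f := gammaPDF a (b y))
        (hpdf.comp measurable_prodMk_left) (g := fun g => κ (y, g) A)
        ((Measure.measurable_coe hA).comp hκy)]
    rfl
  rw [this]
  exact Measurable.lintegral_prod_right'
    (f := fun q : Y × ℝ => gammaPDF a (b q.1) q.2 * κ q A)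
    (hpdf.mul ((Measure.measurable_coe hA).comp hκ))

end Gamma

/-! ### Least squares geometry -/

section LeastSquares

variable {n p : ℕ} (X : Matrix (Fin n) (Fin p) ℝ) (S : Finset (Fin p))

lemma fit_eq (b : EuclideanSpace ℝ S) : fit X S b = mulVecOp (cols X S) b := rfl

lemma lse_eq (y : EuclideanSpace ℝ (Fin n)) :
    lse X S y = mulVecOp (gram X S)⁻¹ (mulVecOp (cols X S)ᵀ y) := rfl

lemma measurable_lse : Measurable (lse X S) := by
  have : lse X S = fun y => mulVecOp (gram X S)⁻¹ (mulVecOp (cols X S)ᵀ y) := rfl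
  rw [this]
  fun_prop

/-- Residual sum of squares. -/
def rss (y : EuclideanSpace ℝ (Fin n)) : ℝ := ‖y - fit X S (lse X S y)‖ ^ 2

lemma measurable_rss : Measurable (rss X S) := by
  have := measurable_lse X S
  unfold rss
  simp_rw [fit_eq]
  fun_prop

lemma rss_nonneg (y : EuclideanSpace ℝ (Fin n)) : 0 ≤ rss X S y := sq_nonneg _

lemma gram_posSemidef : (gram X S).PosSemidef := by
  simpa [gram] using Matrix.posSemidef_conjTranspose_mul_self (cols X S)

lemma gram_inv_posSemidef : (gram X S)⁻¹.PosSemidef := (gram_posSemidef X S).inv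

variable {X S}

lemma mulVecOp_mulVecOp {ι κ l : Type*} [Fintype ι] [Fintype κ] [Fintype l] [DecidableEq κ]
    [DecidableEq l] (M : Matrix ι κ ℝ) (N : Matrix κ l ℝ) (z : EuclideanSpace ℝ l) :
    mulVecOp M (mulVecOp N z) = mulVecOp (M * N) z := by
  simp [mulVecOp_apply, Matrix.mulVec_mulVec]

lemma mulVecOp_smul {ι κ : Type*} [Fintype ι] [Fintype κ] [DecidableEq κ] (c : ℝ)
    (M : Matrix ι κ ℝ) (z : EuclideanSpace ℝ κ) : mulVecOp (c • M) z = c • mulVecOp M z := by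
  rw [mulVecOp_apply, mulVecOp_apply, Matrix.smul_mulVec, WithLp.toLp_smul]

lemma mulVecOp_one {ι : Type*} [Fintype ι] [DecidableEq ι] (z : EuclideanSpace ℝ ι) :
    mulVecOp (1 : Matrix ι ι ℝ) z = z := by
  simp [mulVecOp_apply]

lemma mulVecOp_transpose_residual (hG : IsUnit (gram X S).det) (y : EuclideanSpace ℝ (Fin n)) :
    mulVecOp (cols X S)ᵀ (y - fit X S (lse X S y)) = 0 := by
  rw [map_sub, fit_eq, lse_eq, mulVecOp_mulVecOp, mulVecOp_mulVecOp]
  change _ - mulVecOp (gram X S * (gram X S)⁻¹) _ = 0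
  rw [Matrix.mul_nonsing_inv _ hG, mulVecOp_one, sub_self]

/-- Pythagoras: by the normal equations the residual is orthogonal to the column span. -/
lemma norm_sub_fit_sq (hG : IsUnit (gram X S).det) (y : EuclideanSpace ℝ (Fin n))
    (u : EuclideanSpace ℝ S) :
    ‖y - fit X S (lse X S y + u)‖ ^ 2 = rss X S y + ‖fit X S u‖ ^ 2 := by
  have h : y - fit X S (lse X S y + u) = (y - fit X S (lse X S y)) - fit X S u := by
    rw [fit_eq, fit_eq, fit_eq, map_add, sub_sub]
  have h0 : inner ℝ (y - fit X S (lse X S y)) (fit X S u) = 0 := by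
    rw [real_inner_comm, fit_eq X S u, inner_mulVecOp, mulVecOp_transpose_residual hG,
      inner_zero_right]
  rw [h, norm_sub_sq_real, h0, rss]
  ring

/-- Whitening: with A the square root of G⁻¹, the map z ↦ X_S A z is an isometry because A G A = 1.
In these coordinates the likelihood depends on the coefficients only through ‖z‖. -/
lemma norm_fit_sqrtOp_sq (hG : IsUnit (gram X S).det) (z : EuclideanSpace ℝ S) :
    ‖fit X S (sqrtOp (gram X S)⁻¹ z)‖ ^ 2 = ‖z‖ ^ 2 := by
  obtain ⟨A, hA, hAA, hop⟩ := exists_sqrtOp_eq (gram_inv_posSemidef X S)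
  have hGA : A * (A * gram X S) = 1 := by
    rw [← mul_assoc, hAA, Matrix.nonsing_inv_mul _ hG]
  have hAGA : A * gram X S * A = 1 := mul_eq_one_comm.1 hGA
  rw [fit_eq, hop, mulVecOp_mulVecOp, ← real_inner_self_eq_norm_sq, inner_mulVecOp,
    mulVecOp_mulVecOp, Matrix.transpose_mul, hA,
    show A * (cols X S)ᵀ * (cols X S * A) = A * gram X S * A by simp only [gram, Matrix.mul_assoc],
    hAGA, mulVecOp_one, real_inner_self_eq_norm_sq]

end LeastSquares

/-! ### Conjugate posterior given the model -/

section Posterior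

/-- Reparametrizes the hierarchical prior by an independent pair, the precision g and a standard
Gaussian z, so that a likelihood that factors in (g, z) acts on each coordinate separately. -/
lemma inverseGamma_bind_multivariateGaussian {ι : Type*} [Fintype ι] [DecidableEq ι]
    (a b : ℝ) [SFinite (gammaMeasure a b)] {c : ℝ} (hc : 0 < c) (m : EuclideanSpace ℝ ι) {S : Matrix ι ι ℝ}
    (hS : S.PosSemidef) :
    ((inverseGamma a b).bind fun v => (multivariateGaussian m ((v / c) • S)).map fun x => (x, v))
      = ((gammaMeasure a b).prod (stdGaussian (EuclideanSpace ℝ ι))).map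
        fun q => (m + √(q.1⁻¹ / c) • sqrtOp S q.2, q.1⁻¹) := by
  have hpos : ∀ᵐ v ∂inverseGamma a b, 0 < v := by
    rw [inverseGamma, ae_map_iff (by fun_prop) measurableSet_Ioi]
    filter_upwards [ae_pos_gammaMeasure a b] with g hg using inv_pos.2 hg
  have hcongr : (fun v => (multivariateGaussian m ((v / c) • S)).map fun x => (x, v))
      =ᵐ[inverseGamma a b] fun v => (stdGaussian (EuclideanSpace ℝ ι)).map
        fun z => (m + √(v / c) • sqrtOp S z, v) := by
    filter_upwards [hpos] with v hv
    rw [multivariateGaussian_smul_eq_map m hS (div_pos hv hc).le,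
      Measure.map_map (by fun_prop) (by fun_prop)]
    rfl
  have hmeas : Measurable fun v : ℝ => (stdGaussian (EuclideanSpace ℝ ι)).map
        fun z => (m + √(v / c) • sqrtOp S z, v) :=
    measurable_map_param _ (by unfold Function.uncurry; fun_prop)
  rw [Measure.bind_congr_right hcongr]
  ext A hA
  have hΦ : Measurable fun q : ℝ × EuclideanSpace ℝ ι =>
      (m + √(q.1⁻¹ / c) • sqrtOp S q.2, q.1⁻¹) := by fun_prop
  rw [Measure.bind_apply hA hmeas.aemeasurable, inverseGamma,
    lintegral_map (f := fun v : ℝ => (stdGaussian (EuclideanSpace ℝ ι)).map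
        (fun z => (m + √(v / c) • sqrtOp S z, v)) A)
      ((Measure.measurable_coe hA).comp hmeas) (by fun_prop), Measure.map_apply hΦ hA, Measure.prod_apply (hΦ hA)]
  refine lintegral_congr fun g => ?_
  rw [Measure.map_apply (by fun_prop) hA]
  rfl

variable {n p : ℕ} (h : Hyper) {X : Matrix (Fin n) (Fin p) ℝ} {S : Finset (Fin p)}

/-- Posterior shape parameter of the error variance. -/
def postShape (n : ℕ) : ℝ := h.a0 + n * h.alpha / 2

/-- Posterior scale parameter of the error variance. -/
def postRate (X : Matrix (Fin n) (Fin p) ℝ) (S : Finset (Fin p))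
    (y : EuclideanSpace ℝ (Fin n)) : ℝ := h.b0 + h.alpha / 2 * rss X S y

lemma postShape_pos : 0 < postShape h n := by
  have := h.a0_pos
  have := h.alpha_pos
  unfold postShape
  positivity

lemma postRate_pos (y : EuclideanSpace ℝ (Fin n)) : 0 < postRate h X S y := by
  have := h.b0_pos
  have := h.alpha_pos
  have := rss_nonneg X S y
  unfold postRate
  positivity

lemma measurable_postRate : Measurable (postRate h X S) := by
  have := measurable_rss X S
  unfold postRate
  fun_prop

/-- The posterior law of `(β_S, σ²)` given `S`. -/
def posteriorLaw (X : Matrix (Fin n) (Fin p) ℝ) (S : Finset (Fin p))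
    (y : EuclideanSpace ℝ (Fin n)) : Measure (EuclideanSpace ℝ S × ℝ) :=
  ((gammaMeasure (postShape h n) (postRate h X S y)).prod
    (stdGaussian (EuclideanSpace ℝ S))).map
      fun q => (lse X S y + √(q.1⁻¹ / (h.alpha + h.gamma)) • sqrtOp (gram X S)⁻¹ q.2, q.1⁻¹)

instance (y : EuclideanSpace ℝ (Fin n)) : IsProbabilityMeasure (posteriorLaw h X S y) := by
  have := isProbabilityMeasure_gammaMeasure (postShape_pos h (n := n))
    (postRate_pos h (X := X) (S := S) y)
  exact Measure.isProbabilityMeasure_map (by fun_prop)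

/-- The marginal likelihood of the model `S`. -/
def evidence (X : Matrix (Fin n) (Fin p) ℝ) (S : Finset (Fin p))
    (y : EuclideanSpace ℝ (Fin n)) : ℝ≥0∞ :=
  ENNReal.ofReal ((2 * Real.pi) ^ (-(n * h.alpha / 2))) *
    (ENNReal.ofReal (gammaTilt h.a0 h.b0 (n * h.alpha / 2) (h.alpha / 2 * rss X S y)) *
      ENNReal.ofReal (√(1 + h.alpha / h.gamma))⁻¹ ^ S.card)

lemma measurable_evidence : Measurable (evidence h X S) := by
  have := measurable_rss X S
  unfold evidence gammaTilt
  fun_prop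

lemma evidence_ne_top (y : EuclideanSpace ℝ (Fin n)) : evidence h X S y ≠ ∞ :=
  ENNReal.mul_ne_top ENNReal.ofReal_ne_top
    (ENNReal.mul_ne_top ENNReal.ofReal_ne_top (ENNReal.pow_ne_top ENNReal.ofReal_ne_top))

lemma evidence_ne_zero (y : EuclideanSpace ℝ (Fin n)) : evidence h X S y ≠ 0 := by
  have h1 := h.alpha_pos
  have h2 := h.gamma_pos
  have h3 := rss_nonneg X S y
  have h4 := gammaTilt_pos h.a0_pos h.b0_pos (k := n * h.alpha / 2) (r := h.alpha / 2 * rss X S y)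
    (by positivity) (by positivity)
  refine mul_ne_zero ?_ (mul_ne_zero ?_ (pow_ne_zero _ ?_)) <;>
    rw [← pos_iff_ne_zero, ENNReal.ofReal_pos]
  · positivity
  · exact h4
  · positivity

lemma measurable_fracLik (y : EuclideanSpace ℝ (Fin n)) : Measurable (fracLik h X S y) := by
  unfold fracLik
  simp_rw [fit_eq]
  fun_prop

/-- Conjugacy: the unnormalized posterior given `S`. -/
lemma unnormPosterior_eq (hG : IsUnit (gram X S).det) (y : EuclideanSpace ℝ (Fin n)) :
    unnormPosterior h X S y = evidence h X S y • posteriorLaw h X S y := by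
  have hα := h.alpha_pos
  have hγ := h.gamma_pos
  have hrss := rss_nonneg X S y
  have hp := isProbabilityMeasure_gammaMeasure h.a0_pos h.b0_pos
  have hp' := isProbabilityMeasure_gammaMeasure (postShape_pos h (n := n))
    (postRate_pos h (X := X) (S := S) y)
  set k : ℝ := n * h.alpha / 2 with hk
  have hk0 : 0 ≤ k := by positivity
  set r : ℝ := h.alpha / 2 * rss X S y with hr
  have hr0 : 0 ≤ r := by positivity
  set τ : ℝ := h.alpha / h.gamma with hτ
  have hτ0 : 0 ≤ τ := by positivity
  set Φ : ℝ × EuclideanSpace ℝ S → EuclideanSpace ℝ S × ℝ :=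
    fun q => (lse X S y + √(q.1⁻¹ / h.gamma) • sqrtOp (gram X S)⁻¹ q.2, q.1⁻¹) with hΦ
  have hΦm : Measurable Φ := by fun_prop
  have hprior : paramPrior h X S y
      = ((gammaMeasure h.a0 h.b0).prod (stdGaussian (EuclideanSpace ℝ S))).map Φ :=
    inverseGamma_bind_multivariateGaussian _ _ hγ _ (gram_inv_posSemidef X S)
  -- The squared distance is rss + ‖z‖²/(gγ). Multiplied by αg/2, its second term loses g, so the
  -- likelihood separates.
  have hdens : (fun q => fracLik h X S y (Φ q))
      =ᵐ[(gammaMeasure h.a0 h.b0).prod (stdGaussian (EuclideanSpace ℝ S))]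
      ENNReal.ofReal ((2 * Real.pi) ^ (-k)) • fun q =>
        ENNReal.ofReal (q.1 ^ k * Real.exp (-(r * q.1))) *
          ENNReal.ofReal (Real.exp (-(τ / 2) * ‖q.2‖ ^ 2)) := by
    filter_upwards [Measure.quasiMeasurePreserving_fst.ae (ae_pos_gammaMeasure h.a0 h.b0)]
      with q hq
    obtain ⟨g, z⟩ := q
    simp only at hq
    simp only [Pi.smul_apply, smul_eq_mul, fracLik, hΦ]
    rw [norm_sub_fit_sq hG, fit_eq, map_smul, ← fit_eq, norm_smul, mul_pow, norm_fit_sqrtOp_sq hG,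
      Real.norm_of_nonneg (Real.sqrt_nonneg _), Real.sq_sqrt (by positivity),
      ← ENNReal.ofReal_mul (by positivity), ← ENNReal.ofReal_mul (by positivity)]
    congr 1
    rw [Real.mul_rpow (by positivity) (by positivity), Real.inv_rpow hq.le, Real.rpow_neg hq.le,
      inv_inv, mul_assoc, mul_assoc, ← Real.exp_add]
    congr 3
    rw [hr, hτ]
    field_simp
    ring
  have hprod : ((gammaMeasure h.a0 h.b0).prod (stdGaussian (EuclideanSpace ℝ S))).withDensity
      (fun q => ENNReal.ofReal (q.1 ^ k * Real.exp (-(r * q.1))) *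
          ENNReal.ofReal (Real.exp (-(τ / 2) * ‖q.2‖ ^ 2)))
      = (ENNReal.ofReal (gammaTilt h.a0 h.b0 k r) * ENNReal.ofReal (√(1 + τ))⁻¹ ^ S.card) •
        ((gammaMeasure (h.a0 + k) (h.b0 + r)).prod (stdGaussian (EuclideanSpace ℝ S))).map
          (Prod.map id ((√(1 + τ))⁻¹ • ·)) := by
    have hsc : Measurable fun z : EuclideanSpace ℝ S => (√(1 + τ))⁻¹ • z := by fun_prop
    have : IsProbabilityMeasure ((stdGaussian (EuclideanSpace ℝ S)).map
      fun z => (√(1 + τ))⁻¹ • z) := Measure.isProbabilityMeasure_map hsc.aemeasurable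
    have : SFinite (gammaMeasure (h.a0 + k) (h.b0 + r)) := by
      unfold gammaMeasure; infer_instance
    rw [← prod_withDensity (μ := gammaMeasure h.a0 h.b0)
      (f := fun g => ENNReal.ofReal (g ^ k * Real.exp (-(r * g))))
      (g := fun z : EuclideanSpace ℝ S => ENNReal.ofReal (Real.exp (-(τ / 2) * ‖z‖ ^ 2)))
      (by fun_prop) (by fun_prop), gammaMeasure_withDensity h.a0_pos h.b0_pos hk0 hr0,
      stdGaussian_withDensity_exp S hτ0, Measure.prod_smul_left, Measure.prod_smul_right, smul_smul,
      Fintype.card_coe, ← Measure.map_prod_map _ _ measurable_id hsc, Measure.map_id]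
  rw [unnormPosterior, hprior, withDensity_map _ hΦm (measurable_fracLik h y),
    withDensity_congr_ae hdens, withDensity_smul _ (by fun_prop), hprod, Measure.map_smul,
    Measure.map_smul, smul_smul, Measure.map_map hΦm (by fun_prop)]
  -- The tilt shrinks z by (1 + α/γ)^(-1/2), and (1/γ)/(1 + α/γ) = 1/(α + γ).
  have hcomp : Φ ∘ Prod.map id ((√(1 + τ))⁻¹ • ·) = fun q : ℝ × EuclideanSpace ℝ S =>
      (lse X S y + √(q.1⁻¹ / (h.alpha + h.gamma)) • sqrtOp (gram X S)⁻¹ q.2, q.1⁻¹) := by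
    funext q
    simp only [hΦ, Function.comp, Prod.map, id, map_smul, smul_smul]
    rw [← Real.sqrt_inv, ← Real.sqrt_mul' _ (by positivity)]
    have : q.1⁻¹ / h.gamma * (1 + τ)⁻¹ = q.1⁻¹ / (h.alpha + h.gamma) := by
      rw [hτ]
      field_simp
      ring
    rw [this]
  rw [hcomp]
  rfl

lemma unnormPosterior_univ (hG : IsUnit (gram X S).det) (y : EuclideanSpace ℝ (Fin n)) :
    unnormPosterior h X S y Set.univ = evidence h X S y := by
  rw [unnormPosterior_eq h hG, Measure.smul_apply, measure_univ, smul_eq_mul, mul_one]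

lemma condPosterior_eq (hG : IsUnit (gram X S).det) (y : EuclideanSpace ℝ (Fin n)) :
    condPosterior h X S y = posteriorLaw h X S y := by
  rw [condPosterior, unnormPosterior_univ h hG, unnormPosterior_eq h hG, smul_smul,
    ENNReal.inv_mul_cancel (evidence_ne_zero h y) (evidence_ne_top h y), one_smul]

end Posterior

/-! ### Predictive laws, model weights and measurability in the data -/

section Predictive

variable {n p d : ℕ} (h : Hyper) {X : Matrix (Fin n) (Fin p) ℝ} {Xt : Matrix (Fin d) (Fin p) ℝ}
  {S : Finset (Fin p)}

/-- The covariance factor of the predictive law given `S` and the error variance. -/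
def predCov (X : Matrix (Fin n) (Fin p) ℝ) (Xt : Matrix (Fin d) (Fin p) ℝ) (S : Finset (Fin p)) :
    Matrix (Fin d) (Fin d) ℝ :=
  1 + (h.alpha + h.gamma)⁻¹ • (cols Xt S * (gram X S)⁻¹ * (cols Xt S)ᵀ)

lemma predCov_posSemidef : (predCov h X Xt S).PosSemidef := by
  have hα := h.alpha_pos
  have hγ := h.gamma_pos
  refine Matrix.PosSemidef.one.add (Matrix.PosSemidef.smul ?_ (by positivity))
  simpa using (gram_inv_posSemidef X S).mul_mul_conjTranspose_same (cols Xt S)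

/-- The predictive law given `S` and the error precision `g`. -/
def scaleGaussian (X : Matrix (Fin n) (Fin p) ℝ) (Xt : Matrix (Fin d) (Fin p) ℝ)
    (S : Finset (Fin p)) (y : EuclideanSpace ℝ (Fin n)) (g : ℝ) :
    Measure (EuclideanSpace ℝ (Fin d)) :=
  (stdGaussian (EuclideanSpace ℝ (Fin d))).map
    fun x => fit Xt S (lse X S y) + √g⁻¹ • sqrtOp (predCov h X Xt S) x

/-- The scale mixture of normal laws that is the predictive law given `S`. -/
def predMixture (X : Matrix (Fin n) (Fin p) ℝ) (Xt : Matrix (Fin d) (Fin p) ℝ)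
    (S : Finset (Fin p)) (y : EuclideanSpace ℝ (Fin n)) : Measure (EuclideanSpace ℝ (Fin d)) :=
  (gammaMeasure (postShape h n) (postRate h X S y)).bind (scaleGaussian h X Xt S y)

lemma measurable_uncurry_scaleGaussian :
    Measurable fun q : EuclideanSpace ℝ (Fin n) × ℝ => scaleGaussian h X Xt S q.1 q.2 := by
  have := measurable_lse X S
  refine measurable_map_param _ (F := fun (q : EuclideanSpace ℝ (Fin n) × ℝ)
    (x : EuclideanSpace ℝ (Fin d)) =>
      fit Xt S (lse X S q.1) + √q.2⁻¹ • sqrtOp (predCov h X Xt S) x) ?_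
  unfold Function.uncurry
  simp_rw [fit_eq]
  fun_prop

lemma measurable_scaleGaussian (y : EuclideanSpace ℝ (Fin n)) :
    Measurable (scaleGaussian h X Xt S y) := by
  refine measurable_map_param _ (F := fun (g : ℝ) (x : EuclideanSpace ℝ (Fin d)) =>
      fit Xt S (lse X S y) + √g⁻¹ • sqrtOp (predCov h X Xt S) x) ?_
  unfold Function.uncurry
  fun_prop

lemma measurable_predMixture : Measurable (predMixture h X Xt S) :=
  measurable_bind_gammaMeasure (postShape h n) (measurable_postRate h (X := X) (S := S))
    (κ := fun q : EuclideanSpace ℝ (Fin n) × ℝ => scaleGaussian h X Xt S q.1 q.2)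
    (measurable_uncurry_scaleGaussian h)

instance (y : EuclideanSpace ℝ (Fin n)) (g : ℝ) :
    IsProbabilityMeasure (scaleGaussian h X Xt S y g) :=
  Measure.isProbabilityMeasure_map (by fun_prop)

lemma scaleGaussian_eq (y : EuclideanSpace ℝ (Fin n)) {g : ℝ} (hg : 0 ≤ g) :
    scaleGaussian h X Xt S y g
      = multivariateGaussian (fit Xt S (lse X S y)) (g⁻¹ • predCov h X Xt S) := by
  rw [scaleGaussian, multivariateGaussian_smul_eq_map _ (predCov_posSemidef h) (inv_nonneg.2 hg)]

instance (y : EuclideanSpace ℝ (Fin n)) : IsProbabilityMeasure (predMixture h X Xt S y) := by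
  have := isProbabilityMeasure_gammaMeasure (postShape_pos h (n := n))
    (postRate_pos h (X := X) (S := S) y)
  exact isProbabilityMeasure_bind (measurable_scaleGaussian h y).aemeasurable
    (Eventually.of_forall fun g => inferInstance)

lemma ae_pos_posteriorLaw (y : EuclideanSpace ℝ (Fin n)) :
    ∀ᵐ θ ∂posteriorLaw h X S y, 0 < θ.2 := by
  have := isProbabilityMeasure_gammaMeasure (postShape_pos h (n := n))
    (postRate_pos h (X := X) (S := S) y)
  rw [posteriorLaw, ae_map_iff (by fun_prop) (measurableSet_lt measurable_const measurable_snd)]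
  filter_upwards [Measure.quasiMeasurePreserving_fst.ae
    (ae_pos_gammaMeasure (postShape h n) (postRate h X S y))] with q hq using inv_pos.2 hq

/-- The conditional predictive law is a scale mixture of normal laws. -/
lemma condPredictive_eq (hG : IsUnit (gram X S).det) (y : EuclideanSpace ℝ (Fin n)) :
    condPredictive h X Xt S y = predMixture h X Xt S y := by
  have hα := h.alpha_pos
  have hγ := h.gamma_pos
  have := isProbabilityMeasure_gammaMeasure (postShape_pos h (n := n))
    (postRate_pos h (X := X) (S := S) y)
  obtain ⟨A, hA, hAA, hop⟩ := exists_sqrtOp_eq (gram_inv_posSemidef X S)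
  have hsphere : ∀ (m : EuclideanSpace ℝ (Fin d)) (v : ℝ), 0 < v →
      (stdGaussian (EuclideanSpace ℝ (Fin d))).map (fun x => m + √v • x)
        = multivariateGaussian m (v • (1 : Matrix (Fin d) (Fin d) ℝ)) := fun m v hv => by
    rw [multivariateGaussian_smul_eq_map m Matrix.PosSemidef.one hv.le, sqrtOp_one]
    rfl
  -- The explicit image measure is visibly measurable in θ. It agrees with the Gaussian law where
  -- the variance is positive, hence almost surely under the posterior.
  have hcongr : (fun θ : EuclideanSpace ℝ S × ℝ =>
        multivariateGaussian (fit Xt S θ.1) (θ.2 • (1 : Matrix (Fin d) (Fin d) ℝ)))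
      =ᵐ[posteriorLaw h X S y] fun θ => (stdGaussian (EuclideanSpace ℝ (Fin d))).map
        fun x => fit Xt S θ.1 + √θ.2 • x := by
    filter_upwards [ae_pos_posteriorLaw h y] with θ hθ
    rw [hsphere _ _ hθ]
  have hmeas : Measurable fun θ : EuclideanSpace ℝ S × ℝ =>
      (stdGaussian (EuclideanSpace ℝ (Fin d))).map fun x => fit Xt S θ.1 + √θ.2 • x := by
    refine measurable_map_param _ ?_
    unfold Function.uncurry
    simp_rw [fit_eq]
    fun_prop
  rw [condPredictive, condPosterior_eq h hG, Measure.bind_congr_right hcongr]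
  ext E hE
  have hmE := (Measure.measurable_coe hE).comp hmeas
  have hΦ : Measurable fun q : ℝ × EuclideanSpace ℝ S =>
    (lse X S y + √(q.1⁻¹ / (h.alpha + h.gamma)) • sqrtOp (gram X S)⁻¹ q.2, q.1⁻¹) := by fun_prop
  rw [Measure.bind_apply hE hmeas.aemeasurable, posteriorLaw, predMixture,
    Measure.bind_apply hE (measurable_scaleGaussian h y).aemeasurable,
    lintegral_map (f := fun θ : EuclideanSpace ℝ S × ℝ =>
      (stdGaussian (EuclideanSpace ℝ (Fin d))).map (fun x => fit Xt S θ.1 + √θ.2 • x) E) hmE hΦ]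
  refine (lintegral_prod _ (hmE.comp hΦ).aemeasurable).trans (lintegral_congr_ae ?_)
  filter_upwards [ae_pos_gammaMeasure (postShape h n) (postRate h X S y)] with g hg
  have hg' : 0 < g⁻¹ := inv_pos.2 hg
  set M : Matrix (Fin d) S ℝ := √(g⁻¹ / (h.alpha + h.gamma)) • (cols Xt S * A) with hM
  have hfit : ∀ z, fit Xt S (lse X S y + √(g⁻¹ / (h.alpha + h.gamma)) • sqrtOp (gram X S)⁻¹ z)
      = fit Xt S (lse X S y) + mulVecOp M z := fun z => by
    rw [fit_eq, fit_eq, map_add, map_smul, hop, mulVecOp_mulVecOp, hM, mulVecOp_smul]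
  have hcov : g⁻¹ • (1 : Matrix (Fin d) (Fin d) ℝ) + M * Mᵀ = g⁻¹ • predCov h X Xt S := by
    rw [hM, Matrix.transpose_smul, Matrix.smul_mul, Matrix.mul_smul, smul_smul,
      Real.mul_self_sqrt (by positivity), Matrix.transpose_mul, hA,
      show cols Xt S * A * (A * (cols Xt S)ᵀ) = cols Xt S * (gram X S)⁻¹ * (cols Xt S)ᵀ by
        rw [← hAA]; simp only [Matrix.mul_assoc], predCov, smul_add, smul_smul, div_eq_mul_inv]
  simp only [Function.comp_apply, hfit, hsphere _ _ hg']
  rw [← Measure.bind_apply hE (measurable_multivariateGaussian (by fun_prop) _).aemeasurable,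
    stdGaussian_bind_multivariateGaussian _ _ hg'.le, hcov,
    scaleGaussian_eq h y hg.le]

lemma modelPrior_ne_top (T : Finset (Fin p)) : modelPrior h X T ≠ ∞ := by
  unfold modelPrior
  split_ifs
  · exact ENNReal.ofReal_ne_top
  · exact ENNReal.zero_ne_top

/-- The empty model is admissible for every rank, so the normalizing sum of the model posterior
never vanishes. -/
lemma modelPrior_empty_ne_zero : modelPrior h X ∅ ≠ 0 := by
  have hc := h.c_pos
  have hle : ∀ k, 0 ≤ ((h.c * (p : ℝ) ^ h.a) ^ k)⁻¹ := fun k => by positivity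
  have hsum : 0 < ∑ k ∈ Finset.range (X.rank + 1), ((h.c * (p : ℝ) ^ h.a) ^ k)⁻¹ :=
    Finset.sum_pos' (fun k _ => hle k) ⟨0, by simp, by simp⟩
  simp only [modelPrior, Finset.card_empty, Nat.zero_le, if_true, Nat.choose_zero_right,
    Nat.cast_one, inv_one, one_mul, pow_zero, one_div]
  rw [← pos_iff_ne_zero, ENNReal.ofReal_pos]
  positivity

lemma modelPrior_eq_zero (hS : ¬ S.card ≤ X.rank) : modelPrior h X S = 0 := if_neg hS

variable (hX : ∀ S : Finset (Fin p), S.card ≤ X.rank → IsUnit (gram X S).det)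
include hX

lemma modelPrior_mul_unnormPosterior (S : Finset (Fin p)) (y : EuclideanSpace ℝ (Fin n)) :
    modelPrior h X S * unnormPosterior h X S y Set.univ = modelPrior h X S * evidence h X S y := by
  by_cases hS : S.card ≤ X.rank
  · rw [unnormPosterior_univ h (hX S hS)]
  · rw [modelPrior_eq_zero h hS, zero_mul, zero_mul]

lemma modelPosterior_eq (S : Finset (Fin p)) (y : EuclideanSpace ℝ (Fin n)) :
    modelPosterior h X S y = modelPrior h X S * evidence h X S y /
      ∑ T : Finset (Fin p), modelPrior h X T * evidence h X T y := by
  simp only [modelPosterior, modelPrior_mul_unnormPosterior h hX]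

lemma measurable_modelPosterior (S : Finset (Fin p)) : Measurable (modelPosterior h X S) := by
  have hm : ∀ T : Finset (Fin p), Measurable (evidence h X T) := fun T => measurable_evidence h
  rw [funext (modelPosterior_eq h hX S)]
  exact ((hm S).const_mul _).div (Finset.measurable_sum _ fun T _ => (hm T).const_mul _)

lemma sum_modelPosterior (y : EuclideanSpace ℝ (Fin n)) :
    ∑ S : Finset (Fin p), modelPosterior h X S y = 1 := by
  simp_rw [modelPosterior_eq h hX, div_eq_mul_inv]
  rw [← Finset.sum_mul]
  refine ENNReal.mul_inv_cancel ?_ ?_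
  · rw [Ne, Finset.sum_eq_zero_iff]
    exact fun hz => mul_ne_zero (modelPrior_empty_ne_zero h) (evidence_ne_zero h y)
      (hz ∅ (Finset.mem_univ _))
  · exact ENNReal.sum_ne_top.2 fun T _ =>
      ENNReal.mul_ne_top (modelPrior_ne_top h T) (evidence_ne_top h y)

/-- Beyond the rank the conjugate formula is unavailable, as the Gram matrix may be singular, but
such models carry zero weight. -/
lemma modelPosterior_smul_condPredictive (S : Finset (Fin p)) (y : EuclideanSpace ℝ (Fin n)) :
    modelPosterior h X S y • condPredictive h X Xt S y
      = modelPosterior h X S y • predMixture h X Xt S y := by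
  by_cases hS : S.card ≤ X.rank
  · rw [condPredictive_eq h (hX S hS)]
  · rw [modelPosterior_eq h hX, modelPrior_eq_zero h hS, zero_mul, ENNReal.zero_div, zero_smul,
      zero_smul]

lemma predictive_eq (y : EuclideanSpace ℝ (Fin n)) :
    predictive h X Xt y = ∑ S : Finset (Fin p), modelPosterior h X S y • predMixture h X Xt S y :=
  Finset.sum_congr rfl fun S _ => modelPosterior_smul_condPredictive h hX S y

lemma measurable_predictive : Measurable (predictive h X Xt) := by
  rw [funext (predictive_eq h hX)]
  refine Measure.measurable_of_measurable_coe _ fun A hA => ?_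
  simp only [Measure.finsetSum_apply, Measure.smul_apply, smul_eq_mul]
  exact Finset.measurable_sum _ fun S _ => (measurable_modelPosterior h hX S).mul
    ((Measure.measurable_coe hA).comp (measurable_predMixture h))

lemma isProbabilityMeasure_predictive (y : EuclideanSpace ℝ (Fin n)) :
    IsProbabilityMeasure (predictive h X Xt y) := by
  refine ⟨?_⟩
  rw [predictive_eq h hX, Measure.finsetSum_apply]
  simp only [Measure.smul_apply, measure_univ, smul_eq_mul, mul_one]
  exact sum_modelPosterior h hX y

lemma modelPosterior_le_one (S : Finset (Fin p)) (y : EuclideanSpace ℝ (Fin n)) :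
    modelPosterior h X S y ≤ 1 := by
  rw [← sum_modelPosterior h hX y]
  exact Finset.single_le_sum (f := fun S => modelPosterior h X S y) (fun _ _ => zero_le)
    (Finset.mem_univ S)

/-- The predictive law is close to its component at a model of large posterior probability. -/
lemma tvDist_predictive_predMixture_le (S : Finset (Fin p)) (y : EuclideanSpace ℝ (Fin n)) :
    tvDist (predictive h X Xt y) (predMixture h X Xt S y) ≤ 1 - modelPosterior h X S y := by
  have := isProbabilityMeasure_predictive h (Xt := Xt) hX y
  refine tvDist_le_of_smul_le (modelPosterior_le_one h hX S y) ?_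
  rw [predictive_eq h hX, Measure.le_iff']
  intro A
  rw [Measure.finsetSum_apply]
  exact Finset.single_le_sum
    (f := fun S => (modelPosterior h X S y • predMixture h X Xt S y) A) (fun _ _ => zero_le)
    (Finset.mem_univ S)

omit hX

/-- Total variation between the laws `N(m, v Σ)` and `N(m, w Σ)` is at most this function of
`v / w`. -/
def scaleGap (d : ℕ) (t : ℝ) : ℝ := 1 - √(min t t⁻¹) ^ d

/-- Each component of the mixture shares its centre and shape matrix with the target, so only the
ratio of scales matters. -/
lemma tvDist_predMixture_normalPredictive_le {s : ℝ} (hs : 0 < s) (y : EuclideanSpace ℝ (Fin n)) :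
    tvDist (predMixture h X Xt S y) (normalPredictive h X Xt s S y)
      ≤ ∫⁻ g, ENNReal.ofReal (scaleGap d (g⁻¹ / s ^ 2))
        ∂gammaMeasure (postShape h n) (postRate h X S y) := by
  have := isProbabilityMeasure_gammaMeasure (postShape_pos h (n := n))
    (postRate_pos h (X := X) (S := S) y)
  have : IsProbabilityMeasure (normalPredictive h X Xt s S y) := by
    unfold normalPredictive; infer_instance
  refine tvDist_bind_le _
    (measurable_scaleGaussian h y).aemeasurable (fun g => inferInstance) _ ?_
  filter_upwards [ae_pos_gammaMeasure (postShape h n) (postRate h X S y)] with g hg A hA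
  have hg' : 0 < g⁻¹ := inv_pos.2 hg
  rw [scaleGaussian_eq h y hg.le]
  have := abs_multivariateGaussian_real_sub_le (fit Xt S (lse X S y))
    (predCov_posSemidef h (X := X) (Xt := Xt) (S := S)) hg' (pow_pos hs 2) hA
  rwa [Fintype.card_fin, ← inv_div (g⁻¹)] at this

lemma measurable_normalPredictive (s : ℝ) : Measurable (normalPredictive h X Xt s S) := by
  have := measurable_lse X S
  refine measurable_multivariateGaussian ?_ _
  simp_rw [fit_eq]
  fun_prop

end Predictive

/-! ### Moments of Gaussian quadratic forms -/

section Moments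

lemma memLp_sq_gaussianReal : MemLp (fun x : ℝ => x ^ 2) 2 (gaussianReal 0 1) := by
  rw [memLp_two_iff_integrable_sq (by fun_prop)]
  have h := (memLp_id_gaussianReal (μ := 0) (v := 1) 4).integrable_norm_pow (by norm_num)
  refine h.congr (Eventually.of_forall fun x => ?_)
  simp [← pow_mul, Even.pow_abs (show Even 4 by decide)]

lemma integral_sq_gaussianReal : ∫ x : ℝ, x ^ 2 ∂gaussianReal 0 1 = 1 := by
  have h := variance_id_gaussianReal (μ := 0) (v := 1)
  rw [variance_of_integral_eq_zero (by fun_prop) (by simp)] at h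
  simpa using h

/-- The variance of the square of a standard normal variable. -/
def chiSqVar : ℝ := Var[fun x : ℝ => x ^ 2; gaussianReal 0 1]

lemma chiSqVar_nonneg : 0 ≤ chiSqVar := variance_nonneg _ _

/-- ‖z‖² is a sum of n independent squares, with mean n and variance n·`chiSqVar`. The first
absolute moment follows from |x| ≤ (x²/√n + √n)/2. -/
lemma lintegral_norm_sq_sub_stdGaussian {n : ℕ} (hn : 0 < n) :
    ∫⁻ z, ENNReal.ofReal |‖z‖ ^ 2 - n| ∂stdGaussian (EuclideanSpace ℝ (Fin n))
      ≤ ENNReal.ofReal (√n * (chiSqVar + 1) / 2) := by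
  have hsn : 0 < √(n : ℝ) := Real.sqrt_pos.2 (by exact_mod_cast hn)
  set W : (Fin n → ℝ) → ℝ := ∑ i, fun x => x i ^ 2 with hW
  have hL2 : ∀ i : Fin n, MemLp (fun x : Fin n → ℝ => x i ^ 2) 2
      (Measure.pi fun _ : Fin n => gaussianReal 0 1) := fun i =>
    memLp_sq_gaussianReal.comp_measurePreserving
      (measurePreserving_eval (fun _ : Fin n => gaussianReal 0 1) i)
  have hWL2 : MemLp W 2 (Measure.pi fun _ : Fin n => gaussianReal 0 1) :=
    memLp_finsetSum' _ fun i _ => hL2 i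
  have hvar : Var[W; Measure.pi fun _ : Fin n => gaussianReal 0 1] = n * chiSqVar := by
    rw [hW, variance_sum_pi (X := fun _ x => x ^ 2) (fun _ => memLp_sq_gaussianReal)]
    simp [chiSqVar]
  have hmean : ∫ x, W x ∂(Measure.pi fun _ : Fin n => gaussianReal 0 1) = n := by
    simp only [hW, Finset.sum_apply]
    rw [integral_finsetSum _ fun i _ => (hL2 i).integrable (by norm_num)]
    have : ∀ i : Fin n, ∫ x : Fin n → ℝ, x i ^ 2 ∂(Measure.pi fun _ : Fin n => gaussianReal 0 1)
        = 1 := fun i => by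
      rw [← integral_sq_gaussianReal]
      exact integral_comp_eval (μ := fun _ : Fin n => gaussianReal 0 1) (f := fun x => x ^ 2)
        (by fun_prop)
    simp [this]
  have hint : Integrable (fun x => (W x - n) ^ 2) (Measure.pi fun _ : Fin n => gaussianReal 0 1) :=
    (hWL2.sub (memLp_const _)).integrable_sq
  have hsq : ∫ x, (W x - n) ^ 2 ∂(Measure.pi fun _ : Fin n => gaussianReal 0 1)
      = n * chiSqVar := by
    rw [← hvar, variance_eq_integral hWL2.aemeasurable, hmean]
  rw [← map_pi_eq_stdGaussian, lintegral_map (by fun_prop) (by fun_prop)]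
  calc ∫⁻ x, ENNReal.ofReal |‖(WithLp.toLp 2 x : EuclideanSpace ℝ (Fin n))‖ ^ 2 - n|
        ∂(Measure.pi fun _ : Fin n => gaussianReal 0 1)
      ≤ ∫⁻ x, ENNReal.ofReal (((W x - n) ^ 2 / √n + √n) / 2)
        ∂(Measure.pi fun _ : Fin n => gaussianReal 0 1) := by
        refine lintegral_mono fun x => ENNReal.ofReal_le_ofReal ?_
        rw [EuclideanSpace.real_norm_sq_eq]
        have : W x = ∑ i, x i ^ 2 := by simp [hW]
        change |∑ i, x i ^ 2 - (n : ℝ)| ≤ _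
        rw [← this, ← sq_abs (W x - n), le_div_iff₀ two_pos, div_add' _ _ _ hsn.ne', le_div_iff₀ hsn]
        nlinarith [sq_nonneg (|W x - n| - √n)]
    _ = ENNReal.ofReal (√n * (chiSqVar + 1) / 2) := by
        have hint2 : Integrable (fun x => ((W x - n) ^ 2 / √n + √n) / 2)
            (Measure.pi fun _ : Fin n => gaussianReal 0 1) :=
          ((hint.div_const _).add (integrable_const _)).div_const _
        rw [← ofReal_integral_eq_lintegral_ofReal hint2
          (Eventually.of_forall fun x => by positivity), integral_div,
          integral_add (hint.div_const _) (integrable_const _), integral_div, hsq]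
        congr 1
        have : √(n : ℝ) ^ 2 = n := Real.sq_sqrt (Nat.cast_nonneg n)
        simp only [integral_const, probReal_univ, one_smul]
        field_simp
        rw [this]
        ring

lemma integral_inner_mulVecOp_stdGaussian {ι : Type*} [Fintype ι] [DecidableEq ι]
    (M : Matrix ι ι ℝ) :
    Integrable (fun z => inner ℝ z (mulVecOp M z)) (stdGaussian (EuclideanSpace ℝ ι)) ∧
      ∫ z, inner ℝ z (mulVecOp M z) ∂stdGaussian (EuclideanSpace ℝ ι) = M.trace := by
  have hL2 : ∀ i : ι, MemLp (fun z : EuclideanSpace ℝ ι => z i) 2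
      (stdGaussian (EuclideanSpace ℝ ι)) := fun i =>
    (EuclideanSpace.proj (𝕜 := ℝ) i).comp_memLp' IsGaussian.memLp_two_id
  have hint : ∀ i j : ι, Integrable (fun z : EuclideanSpace ℝ ι => z i * z j)
      (stdGaussian (EuclideanSpace ℝ ι)) := fun i j => (hL2 i).integrable_mul (hL2 j)
  have hmean : ∀ i : ι, ∫ z : EuclideanSpace ℝ ι, z i ∂stdGaussian (EuclideanSpace ℝ ι) = 0 :=
    fun i => integral_strongDual_stdGaussian (EuclideanSpace.proj (𝕜 := ℝ) i)
  have hcov : ∀ i j : ι, ∫ z : EuclideanSpace ℝ ι, z i * z j ∂stdGaussian (EuclideanSpace ℝ ι)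
      = (1 : Matrix ι ι ℝ) i j := fun i j => by
    have h := covariance_eval_multivariateGaussian (μ := (0 : EuclideanSpace ℝ ι))
      (Matrix.PosSemidef.one (n := ι) (R := ℝ)) i j
    rw [multivariateGaussian_zero_one, covariance_eq_sub (hL2 i) (hL2 j), hmean, zero_mul,
      sub_zero] at h
    exact h
  have hexp : (fun z : EuclideanSpace ℝ ι => inner ℝ z (mulVecOp M z))
      = fun z => ∑ i, ∑ j, M i j * (z i * z j) := by
    funext z
    simp only [mulVecOp_apply, PiLp.inner_apply, Matrix.mulVec, dotProduct, RCLike.inner_apply,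
      conj_trivial, Finset.sum_mul]
    refine Finset.sum_congr rfl fun i _ => Finset.sum_congr rfl fun j _ => by ring
  rw [hexp]
  have hij : ∀ i j, Integrable (fun z : EuclideanSpace ℝ ι => M i j * (z i * z j))
      (stdGaussian (EuclideanSpace ℝ ι)) := fun i j => (hint i j).const_mul _
  refine ⟨integrable_finsetSum _ fun i _ => integrable_finsetSum _ fun j _ => hij i j, ?_⟩
  rw [integral_finsetSum _ fun i _ => integrable_finsetSum _ fun j _ => hij i j]
  simp_rw [integral_finsetSum _ fun j _ => hij _ j, integral_const_mul, hcov]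
  simp [Matrix.one_apply, Matrix.trace]

end Moments

/-! ### Residual sum of squares under the true model -/

section Residual

variable {n p : ℕ} {X : Matrix (Fin n) (Fin p) ℝ} {S : Finset (Fin p)}

/-- The projection matrix onto the span of the columns in `S`. -/
def hat (X : Matrix (Fin n) (Fin p) ℝ) (S : Finset (Fin p)) : Matrix (Fin n) (Fin n) ℝ :=
  cols X S * (gram X S)⁻¹ * (cols X S)ᵀ

lemma fit_lse (y : EuclideanSpace ℝ (Fin n)) : fit X S (lse X S y) = mulVecOp (hat X S) y := by
  rw [fit_eq, lse_eq, mulVecOp_mulVecOp, mulVecOp_mulVecOp, hat, Matrix.mul_assoc]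

lemma hat_mul_cols (hG : IsUnit (gram X S).det) : hat X S * cols X S = cols X S := by
  rw [hat, Matrix.mul_assoc, Matrix.mul_assoc]
  change cols X S * ((gram X S)⁻¹ * gram X S) = _
  rw [Matrix.nonsing_inv_mul _ hG, Matrix.mul_one]

lemma trace_hat (hG : IsUnit (gram X S).det) : (hat X S).trace = S.card := by
  rw [hat, Matrix.trace_mul_comm, ← Matrix.mul_assoc]
  change (gram X S * (gram X S)⁻¹).trace = _
  rw [Matrix.mul_nonsing_inv _ hG, Matrix.trace_one, Fintype.card_coe]

lemma hat_transpose : (hat X S)ᵀ = hat X S := by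
  have : (gram X S)ᵀ = gram X S := by simp [gram]
  rw [hat, Matrix.transpose_mul, Matrix.transpose_mul, Matrix.transpose_transpose,
    Matrix.transpose_nonsing_inv, this, Matrix.mul_assoc]

lemma hat_mul_hat (hG : IsUnit (gram X S).det) : hat X S * hat X S = hat X S := by
  calc hat X S * hat X S = hat X S * cols X S * (gram X S)⁻¹ * (cols X S)ᵀ := by
        nth_rewrite 2 [hat]
        simp only [Matrix.mul_assoc]
    _ = hat X S := by rw [hat_mul_cols hG, hat]

lemma inner_mulVecOp_hat (hG : IsUnit (gram X S).det) (z : EuclideanSpace ℝ (Fin n)) :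
    inner ℝ z (mulVecOp (hat X S) z) = ‖mulVecOp (hat X S) z‖ ^ 2 := by
  rw [← real_inner_self_eq_norm_sq, inner_mulVecOp, hat_transpose, mulVecOp_mulVecOp,
    hat_mul_hat hG]

lemma mulVecOp_cols_supp (β : Fin p → ℝ) :
    WithLp.toLp 2 (X *ᵥ β) = mulVecOp (cols X (supp β)) (WithLp.toLp 2 fun j => β j) := by
  rw [mulVecOp_apply]
  congr 1
  funext i
  simp only [Matrix.mulVec, dotProduct, cols, Matrix.submatrix_apply, id]
  rw [Finset.sum_coe_sort (supp β) (fun j => X i j * β j)]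
  refine (Finset.sum_subset (Finset.subset_univ _) fun j _ hj => ?_).symm
  have : β j = 0 := by simpa [supp] using hj
  rw [this, mul_zero]

/-- The projection on the true columns fixes the mean Xβ, so only the noise is left in the residual.
-/
lemma rss_eq (β : Fin p → ℝ) (hG : IsUnit (gram X (supp β)).det) (s : ℝ)
    (z : EuclideanSpace ℝ (Fin n)) :
    rss X (supp β) (WithLp.toLp 2 (X *ᵥ β) + s • z)
      = s ^ 2 * (‖z‖ ^ 2 - inner ℝ z (mulVecOp (hat X (supp β)) z)) := by
  rw [rss, fit_lse, map_add, mulVecOp_cols_supp, mulVecOp_mulVecOp, hat_mul_cols hG,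
    add_sub_add_left_eq_sub, map_smul, ← smul_sub, norm_smul, mul_pow, norm_sub_sq_real,
    inner_mulVecOp_hat hG, Real.norm_eq_abs, sq_abs]
  ring

lemma dataLaw_eq {s : ℝ} (hs : 0 < s) (β : Fin p → ℝ) :
    dataLaw X s β = (stdGaussian (EuclideanSpace ℝ (Fin n))).map
      fun z => WithLp.toLp 2 (X *ᵥ β) + s • z := by
  rw [dataLaw, multivariateGaussian_smul_eq_map _ Matrix.PosSemidef.one (sq_nonneg s),
    Real.sqrt_sq hs.le, sqrtOp_one]
  rfl

instance (s : ℝ) (β : Fin p → ℝ) : IsProbabilityMeasure (dataLaw X s β) := by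
  unfold dataLaw; infer_instance

end Residual

/-! ### Concentration of the posterior error variance -/

section Concentration

lemma scaleGap_le_one (d : ℕ) (t : ℝ) : scaleGap d t ≤ 1 := by
  have : 0 ≤ √(min t t⁻¹) ^ d := by positivity
  unfold scaleGap
  linarith

lemma exists_scaleGap_le (d : ℕ) {δ : ℝ} (hδ : 0 < δ) :
    ∃ κ > 0, ∀ u w : ℝ, |u - 1| < κ → |w - 1| < κ → scaleGap d (u / w) ≤ δ := by
  have hc : ContinuousAt (fun q : ℝ × ℝ => scaleGap d (q.1 / q.2)) (1, 1) := by
    unfold scaleGap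
    have hdiv : ContinuousAt (fun q : ℝ × ℝ => q.1 / q.2) (1, 1) :=
      continuousAt_fst.div continuousAt_snd one_ne_zero
    have hinv : ContinuousAt (fun q : ℝ × ℝ => (q.1 / q.2)⁻¹) (1, 1) := hdiv.inv₀ (by norm_num)
    exact continuousAt_const.sub (((hdiv.min hinv).sqrt).pow d)
  obtain ⟨κ, hκ, h⟩ := Metric.continuousAt_iff.1 hc δ hδ
  refine ⟨κ, hκ, fun u w hu hw => ?_⟩
  have hd : dist (u, w) ((1, 1) : ℝ × ℝ) < κ := by
    rw [Prod.dist_eq, max_lt_iff, Real.dist_eq, Real.dist_eq]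
    exact ⟨hu, hw⟩
  have := h hd
  have h0 : scaleGap d (1 / 1) = 0 := by simp [scaleGap]
  rw [Real.dist_eq] at this
  simp only [h0, sub_zero] at this
  exact (le_abs_self _).trans this.le

variable {n p : ℕ} (h : Hyper) {X : Matrix (Fin n) (Fin p) ℝ} {S : Finset (Fin p)}

/-- If the relative errors of both scale factors are below κ, the gap is at most δ; otherwise it is
at most 1. The gamma variable is then handled by Chebyshev. The rate is fixed here, and its error
stays linear so that it can be averaged over the data later. -/
lemma lintegral_scaleGap_le {d : ℕ} {δ κ : ℝ} (hδ : 0 < δ) (hκ : 0 < κ)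
    (hgap : ∀ u w : ℝ, |u - 1| < κ → |w - 1| < κ → scaleGap d (u / w) ≤ δ) {a b : ℝ}
    (ha : 0 < a) (hb : 0 < b) {s : ℝ} (hs : 0 < s) :
    ∫⁻ g, ENNReal.ofReal (scaleGap d (g⁻¹ / s ^ 2)) ∂gammaMeasure a b
      ≤ ENNReal.ofReal (δ + 1 / a / κ ^ 2) + ENNReal.ofReal (|b / (a * s ^ 2) - 1| / κ) := by
  have := isProbabilityMeasure_gammaMeasure ha hb
  have hpt : ∀ᵐ g ∂gammaMeasure a b, ENNReal.ofReal (scaleGap d (g⁻¹ / s ^ 2))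
      ≤ ENNReal.ofReal (δ + |b / (a * s ^ 2) - 1| / κ)
        + ENNReal.ofReal (1 / κ ^ 2) * ENNReal.ofReal ((b / a * g - 1) ^ 2) := by
    filter_upwards [ae_pos_gammaMeasure a b] with g hg
    rw [← ENNReal.ofReal_mul (by positivity), ← ENNReal.ofReal_add (by positivity) (by positivity)]
    refine ENNReal.ofReal_le_ofReal ?_
    -- This separates the data error (numerator) from the posterior fluctuation of g, normalized to
    -- mean 1 (denominator).
    have ht : g⁻¹ / s ^ 2 = (b / (a * s ^ 2)) / (b / a * g) := by field_simp
    have h1 : 0 ≤ |b / (a * s ^ 2) - 1| / κ := by positivity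
    have h2 : 0 ≤ 1 / κ ^ 2 * (b / a * g - 1) ^ 2 := by positivity
    by_cases hu : |b / (a * s ^ 2) - 1| < κ
    · by_cases hw : |b / a * g - 1| < κ
      · have := hgap _ _ hu hw
        rw [ht]
        linarith
      · have hw' : 1 ≤ 1 / κ ^ 2 * (b / a * g - 1) ^ 2 := by
          rw [one_div_mul_eq_div, one_le_div (by positivity), ← sq_abs (b / a * g - 1)]
          exact pow_le_pow_left₀ hκ.le (not_lt.1 hw) 2
        linarith [scaleGap_le_one d (g⁻¹ / s ^ 2)]
    · have hu' : 1 ≤ |b / (a * s ^ 2) - 1| / κ := (one_le_div hκ).2 (not_lt.1 hu)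
      linarith [scaleGap_le_one d (g⁻¹ / s ^ 2)]
  refine (lintegral_mono_ae hpt).trans (le_of_eq ?_)
  rw [lintegral_add_left measurable_const, lintegral_const, measure_univ, mul_one,
    lintegral_const_mul _ (by fun_prop), lintegral_sq_gammaMeasure ha hb,
    ← ENNReal.ofReal_mul (by positivity), ← ENNReal.ofReal_add (by positivity) (by positivity),
    ← ENNReal.ofReal_add (by positivity) (by positivity)]
  congr 1
  field_simp
  ring

/-- Bound on the mean relative error of the posterior scale, for models of size at most `√n`. -/
def scaleError (d1 : ℝ) (n : ℕ) : ℝ :=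
  (h.b0 / d1 + h.a0 + h.alpha / 2 * (√n * (chiSqVar + 1) / 2 + √n)) / (n * h.alpha / 2)

lemma scaleError_tendsto (d1 : ℝ) : Tendsto (scaleError h d1) atTop (𝓝 0) := by
  have hα := h.alpha_pos
  have hsq : Tendsto (fun n : ℕ => (√(n : ℝ))⁻¹) atTop (𝓝 0) :=
    tendsto_inv_atTop_zero.comp (Real.tendsto_sqrt_atTop.comp tendsto_natCast_atTop_atTop)
  have hlim : Tendsto (fun n : ℕ => (h.b0 / d1 + h.a0) * (2 / h.alpha) * ((√(n : ℝ))⁻¹ * (√(n : ℝ))⁻¹)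
      + ((chiSqVar + 1) / 2 + 1) * (√(n : ℝ))⁻¹) atTop (𝓝 0) := by
    simpa using ((hsq.mul hsq).const_mul ((h.b0 / d1 + h.a0) * (2 / h.alpha))).add
      (hsq.const_mul ((chiSqVar + 1) / 2 + 1))
  refine hlim.congr' ?_
  filter_upwards [eventually_gt_atTop 0] with n hn
  have hs : 0 < √(n : ℝ) := Real.sqrt_pos.2 (by exact_mod_cast hn)
  have hn' : (n : ℝ) = √n * √n := (Real.mul_self_sqrt (Nat.cast_nonneg n)).symm
  unfold scaleError
  generalize √(n : ℝ) = r at *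
  rw [hn']
  -- `d1` may be zero here, so the quotient is frozen before denominators are cleared.
  generalize h.b0 / d1 = q
  field_simp

lemma lintegral_postRate_le (β : Fin p → ℝ) (hG : IsUnit (gram X (supp β)).det) {s d1 : ℝ}
    (hs : 0 < s) (hd1 : 0 < d1) (hsd : d1 < s ^ 2) (hn : 0 < n)
    (hcard : ((supp β).card : ℝ) ≤ √n) :
    ∫⁻ y, ENNReal.ofReal |postRate h X (supp β) y / (postShape h n * s ^ 2) - 1| ∂dataLaw X s β
      ≤ ENNReal.ofReal (scaleError h d1 n) := by
  have hα := h.alpha_pos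
  have ha0 := h.a0_pos
  have hb0 := h.b0_pos
  have hV := chiSqVar_nonneg
  have hn' : (0 : ℝ) < n := by exact_mod_cast hn
  have hk : 0 < n * h.alpha / 2 := by positivity
  have ha := postShape_pos h (n := n)
  have hka : n * h.alpha / 2 ≤ postShape h n := by unfold postShape; linarith
  have hm := measurable_postRate h (X := X) (S := supp β)
  obtain ⟨hint, htr⟩ := integral_inner_mulVecOp_stdGaussian (hat X (supp β))
  have hpos : ∀ z, 0 ≤ inner ℝ z (mulVecOp (hat X (supp β)) z) := fun z => by
    rw [inner_mulVecOp_hat hG]; positivity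
  rw [dataLaw_eq hs, lintegral_map (by fun_prop) (by fun_prop)]
  have hpt : ∀ z : EuclideanSpace ℝ (Fin n),
      ENNReal.ofReal |postRate h X (supp β) (WithLp.toLp 2 (X *ᵥ β) + s • z)
          / (postShape h n * s ^ 2) - 1|
        ≤ ENNReal.ofReal (n * h.alpha / 2)⁻¹ * (ENNReal.ofReal (h.b0 / d1 + h.a0) +
          ENNReal.ofReal (h.alpha / 2) * (ENNReal.ofReal |‖z‖ ^ 2 - n| +
            ENNReal.ofReal (inner ℝ z (mulVecOp (hat X (supp β)) z)))) := fun z => by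
    have hq := hpos z
    rw [← ENNReal.ofReal_add (abs_nonneg _) hq, ← ENNReal.ofReal_mul (by positivity),
      ← ENNReal.ofReal_add (by positivity) (by positivity), ← ENNReal.ofReal_mul (by positivity)]
    refine ENNReal.ofReal_le_ofReal ?_
    rw [postRate, rss_eq β hG]
    set q := inner ℝ z (mulVecOp (hat X (supp β)) z)
    -- The leading term nα/2 of the shape cancels against the mean n of ‖z‖², leaving only
    -- fluctuations and bounded terms.
    have e : (h.b0 + h.alpha / 2 * (s ^ 2 * (‖z‖ ^ 2 - q))) / (postShape h n * s ^ 2) - 1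
        = (h.b0 / s ^ 2 - h.a0 + h.alpha / 2 * ((‖z‖ ^ 2 - n) - q)) / postShape h n := by
      field_simp
      unfold postShape
      ring
    rw [e, abs_div, abs_of_pos ha, inv_mul_eq_div]
    refine div_le_div₀ (by positivity) ?_ hk hka
    have h1 : h.b0 / s ^ 2 ≤ h.b0 / d1 := div_le_div_of_nonneg_left hb0.le hd1 hsd.le
    have h2 : 0 ≤ h.b0 / s ^ 2 := by positivity
    have h3 : |(‖z‖ ^ 2 - n) - q| ≤ |‖z‖ ^ 2 - n| + q := by
      refine (abs_sub _ _).trans_eq ?_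
      rw [abs_of_nonneg hq]
    calc |h.b0 / s ^ 2 - h.a0 + h.alpha / 2 * ((‖z‖ ^ 2 - n) - q)|
        ≤ |h.b0 / s ^ 2 - h.a0| + |h.alpha / 2 * ((‖z‖ ^ 2 - n) - q)| := abs_add_le _ _
      _ ≤ (h.b0 / d1 + h.a0) + h.alpha / 2 * (|‖z‖ ^ 2 - n| + q) := by
          refine add_le_add ?_ ?_
          · rw [abs_le]; constructor <;> linarith
          · rw [abs_mul, abs_of_pos (half_pos hα)]
            exact mul_le_mul_of_nonneg_left h3 (half_pos hα).le
  refine (lintegral_mono hpt).trans ?_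
  have hinner : ∫⁻ z, ENNReal.ofReal (inner ℝ z (mulVecOp (hat X (supp β)) z))
      ∂stdGaussian (EuclideanSpace ℝ (Fin n)) = ENNReal.ofReal (supp β).card := by
    rw [← ofReal_integral_eq_lintegral_ofReal hint (Eventually.of_forall hpos), htr, trace_hat hG]
  rw [lintegral_const_mul _ (by fun_prop), lintegral_add_left measurable_const, lintegral_const,
    measure_univ, mul_one, lintegral_const_mul _ (by fun_prop), lintegral_add_left (by fun_prop),
    hinner]
  calc _ ≤ ENNReal.ofReal (n * h.alpha / 2)⁻¹ * (ENNReal.ofReal (h.b0 / d1 + h.a0) +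
          ENNReal.ofReal (h.alpha / 2) * (ENNReal.ofReal (√n * (chiSqVar + 1) / 2) +
            ENNReal.ofReal √n)) := by
        gcongr
        exact lintegral_norm_sq_sub_stdGaussian hn
    _ = ENNReal.ofReal (scaleError h d1 n) := by
        rw [← ENNReal.ofReal_add (by positivity) (by positivity),
          ← ENNReal.ofReal_mul (by positivity),
          ← ENNReal.ofReal_add (by positivity) (by positivity), ← ENNReal.ofReal_mul (by positivity),
          inv_mul_eq_div]
        rfl

end Concentration

/-! ### Expected total variation at a fixed sample size -/

section Limit

variable {n p d : ℕ} (h : Hyper) {X : Matrix (Fin n) (Fin p) ℝ} {Xt : Matrix (Fin d) (Fin p) ℝ}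

lemma isProbabilityMeasure_normalPredictive (s : ℝ) (S : Finset (Fin p))
    (y : EuclideanSpace ℝ (Fin n)) : IsProbabilityMeasure (normalPredictive h X Xt s S y) := by
  unfold normalPredictive; infer_instance

lemma lintegral_tvDist_le (hX : ∀ S : Finset (Fin p), S.card ≤ X.rank → IsUnit (gram X S).det)
    {δ κ : ℝ} (hδ : 0 < δ) (hκ : 0 < κ)
    (hgap : ∀ u w : ℝ, |u - 1| < κ → |w - 1| < κ → scaleGap d (u / w) ≤ δ)
    (β : Fin p → ℝ) (hrank : (supp β).card ≤ X.rank) {s d1 : ℝ}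
    (hs : 0 < s) (hd1 : 0 < d1) (hsd : d1 < s ^ 2) (hn : 0 < n)
    (hcard : ((supp β).card : ℝ) ≤ √n) :
    ∫⁻ y, tvDist (predictive h X Xt y) (normalPredictive h X Xt s (supp β) y) ∂dataLaw X s β
      ≤ (1 - ∫⁻ y, modelPosterior h X (supp β) y ∂dataLaw X s β)
        + ENNReal.ofReal (δ + 1 / postShape h n / κ ^ 2 + scaleError h d1 n / κ) := by
  have ha := postShape_pos h (n := n)
  have hπ := measurable_modelPosterior h hX (supp β)
  have hrate := measurable_postRate h (X := X) (S := supp β)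
  have hα := h.alpha_pos
  have ha0 := h.a0_pos
  have hb0 := h.b0_pos
  have hV := chiSqVar_nonneg
  have herr : 0 ≤ scaleError h d1 n := by unfold scaleError; positivity
  have hπle : ∫⁻ y, modelPosterior h X (supp β) y ∂dataLaw X s β ≤ 1 := by
    refine (lintegral_mono fun y => modelPosterior_le_one h hX _ y).trans ?_
    simp
  calc ∫⁻ y, tvDist (predictive h X Xt y) (normalPredictive h X Xt s (supp β) y) ∂dataLaw X s β
      ≤ ∫⁻ y, ((1 - modelPosterior h X (supp β) y) + (ENNReal.ofReal (δ + 1 / postShape h n / κ ^ 2)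
          + ENNReal.ofReal κ⁻¹ * ENNReal.ofReal
            |postRate h X (supp β) y / (postShape h n * s ^ 2) - 1|)) ∂dataLaw X s β := by
        refine lintegral_mono fun y => ?_
        refine (tvDist_triangle _ (predMixture h X Xt (supp β) y) _).trans (add_le_add
          (tvDist_predictive_predMixture_le h hX _ y) ?_)
        refine (tvDist_predMixture_normalPredictive_le h hs y).trans
          ((lintegral_scaleGap_le hδ hκ hgap ha (postRate_pos h y) hs).trans_eq ?_)
        rw [← ENNReal.ofReal_mul (by positivity), inv_mul_eq_div]
    _ = (1 - ∫⁻ y, modelPosterior h X (supp β) y ∂dataLaw X s β)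
          + (ENNReal.ofReal (δ + 1 / postShape h n / κ ^ 2)
          + ENNReal.ofReal κ⁻¹ * ∫⁻ y, ENNReal.ofReal
            |postRate h X (supp β) y / (postShape h n * s ^ 2) - 1| ∂dataLaw X s β) := by
        rw [lintegral_add_left (f := fun y => 1 - modelPosterior h X (supp β) y)
            (measurable_const.sub hπ), lintegral_add_left measurable_const,
          lintegral_const_mul _ (by fun_prop), lintegral_sub hπ
            (ne_top_of_le_ne_top ENNReal.one_ne_top hπle)
            (Eventually.of_forall fun y => modelPosterior_le_one h hX _ y)]
        simp
    _ ≤ (1 - ∫⁻ y, modelPosterior h X (supp β) y ∂dataLaw X s β)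
          + (ENNReal.ofReal (δ + 1 / postShape h n / κ ^ 2)
          + ENNReal.ofReal κ⁻¹ * ENNReal.ofReal (scaleError h d1 n)) := by
        gcongr
        exact lintegral_postRate_le h β (hX _ hrank) hs hd1 hsd hn hcard
    _ = _ := by
        rw [← ENNReal.ofReal_mul (by positivity), ← ENNReal.ofReal_add (by positivity) (by positivity),
          inv_mul_eq_div]

end Limit

end EmpPrior

end

/-! ### The uniform limit -/

theorem theorem7 (h : EmpPrior.Hyper) (d : ℕ) (p : ℕ → ℕ)
    (X : ∀ n, Matrix (Fin n) (Fin (p n)) ℝ)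
    (Xt : ∀ n, Matrix (Fin d) (Fin (p n)) ℝ)
    (hX : ∀ n, ∀ S : Finset (Fin (p n)), S.card ≤ (X n).rank → IsUnit (EmpPrior.gram (X n) S).det)
    (sigma0 : ℕ → ℝ) (d1 d2 : ℝ) (hd1 : 0 < d1)
    (hsigma0 : ∀ n, 0 < sigma0 n ∧ d1 < sigma0 n ^ 2 ∧ sigma0 n ^ 2 < d2)
    (B : ∀ n, Set (Fin (p n) → ℝ))
    (hsparse : ∀ ε : ℝ, 0 < ε → ∀ᶠ n : ℕ in atTop, ∀ β ∈ B n,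
      ((EmpPrior.supp β).card : ℝ) ≤ ε * (√(n : ℝ) / Real.log n))
    (hselect : ∀ ε : ℝ≥0∞, 0 < ε → ∀ᶠ n : ℕ in atTop, ∀ β ∈ B n,
      1 - ε ≤ ∫⁻ y, EmpPrior.modelPosterior h (X n) (EmpPrior.supp β) y
        ∂(EmpPrior.dataLaw (X n) (sigma0 n) β)) :
    (∀ n, ∀ β ∈ B n,
      AEMeasurable (fun y => EmpPrior.hellingerSq (EmpPrior.predictive h (X n) (Xt n) y)
        (EmpPrior.normalPredictive h (X n) (Xt n) (sigma0 n) (EmpPrior.supp β) y))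
        (EmpPrior.dataLaw (X n) (sigma0 n) β) ∧
      AEMeasurable (fun y => EmpPrior.tvDist (EmpPrior.predictive h (X n) (Xt n) y)
        (EmpPrior.normalPredictive h (X n) (Xt n) (sigma0 n) (EmpPrior.supp β) y))
        (EmpPrior.dataLaw (X n) (sigma0 n) β)) ∧
    Tendsto (fun n => ⨆ β ∈ B n,
      ∫⁻ y, EmpPrior.hellingerSq (EmpPrior.predictive h (X n) (Xt n) y)
        (EmpPrior.normalPredictive h (X n) (Xt n) (sigma0 n) (EmpPrior.supp β) y)
        ∂(EmpPrior.dataLaw (X n) (sigma0 n) β)) atTop (𝓝 0) ∧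
    Tendsto (fun n => ⨆ β ∈ B n,
      ∫⁻ y, EmpPrior.tvDist (EmpPrior.predictive h (X n) (Xt n) y)
        (EmpPrior.normalPredictive h (X n) (Xt n) (sigma0 n) (EmpPrior.supp β) y)
        ∂(EmpPrior.dataLaw (X n) (sigma0 n) β)) atTop (𝓝 0) := by
  have hpred : ∀ n y, IsProbabilityMeasure (EmpPrior.predictive h (X n) (Xt n) y) := fun n y =>
    EmpPrior.isProbabilityMeasure_predictive h (hX n) y
  have hnorm : ∀ n S y, IsProbabilityMeasure
      (EmpPrior.normalPredictive h (X n) (Xt n) (sigma0 n) S y) := fun n S y =>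
    EmpPrior.isProbabilityMeasure_normalPredictive h _ S y
  have htv : Tendsto (fun n => ⨆ β ∈ B n,
      ∫⁻ y, EmpPrior.tvDist (EmpPrior.predictive h (X n) (Xt n) y)
        (EmpPrior.normalPredictive h (X n) (Xt n) (sigma0 n) (EmpPrior.supp β) y)
        ∂(EmpPrior.dataLaw (X n) (sigma0 n) β)) atTop (𝓝 0) := by
    rw [ENNReal.tendsto_nhds_zero]
    intro ε hε
    -- One η pays for model selection and one for the scale error. Capping at 1 gives η < 1, which
    -- the rank argument needs.
    set η : ℝ≥0∞ := min ε 1 / 2 with hη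
    have hmin : min ε 1 ≠ 0 := (lt_min hε one_pos).ne'
    have hmint : min ε 1 ≠ ∞ := ne_top_of_le_ne_top ENNReal.one_ne_top (min_le_right _ _)
    have hη0 : 0 < η := ENNReal.half_pos hmin
    have hη1 : η < 1 := (ENNReal.half_lt_self hmin hmint).trans_le (min_le_right _ _)
    have hηt : η ≠ ∞ := hη1.ne_top
    have hx : 0 < η.toReal := ENNReal.toReal_pos hη0.ne' hηt
    obtain ⟨κ, hκ, hgap⟩ := EmpPrior.exists_scaleGap_le d (half_pos hx)
    have hshape : Tendsto (fun n : ℕ => 1 / EmpPrior.postShape h n) atTop (𝓝 0) := by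
      have : Tendsto (fun n : ℕ => EmpPrior.postShape h n) atTop atTop := by
        unfold EmpPrior.postShape
        refine tendsto_atTop_add_const_left _ _ ?_
        exact (tendsto_natCast_atTop_atTop.atTop_mul_const h.alpha_pos).atTop_div_const two_pos
      simpa [Function.comp_def] using tendsto_inv_atTop_zero.comp this
    have hrem : Tendsto (fun n : ℕ => 1 / EmpPrior.postShape h n / κ ^ 2
        + EmpPrior.scaleError h d1 n / κ) atTop (𝓝 0) := by
      simpa using (hshape.div_const (κ ^ 2)).add ((EmpPrior.scaleError_tendsto h d1).div_const κ)
    filter_upwards [hrem.eventually_lt_const (half_pos hx), hselect η hη0, hsparse 1 one_pos,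
      eventually_ge_atTop 3] with n hn1 hn2 hn3 hn4
    refine iSup₂_le fun β hβ => ?_
    obtain ⟨hs, hsd, -⟩ := hsigma0 n
    -- The rank bound on the true support follows from selection: a model larger than the rank has
    -- posterior probability zero, against the lower bound 1 - η > 0.
    have hrank : (EmpPrior.supp β).card ≤ (X n).rank := by
      by_contra hr
      have h0 := hn2 β hβ
      have hz : ∀ y, EmpPrior.modelPosterior h (X n) (EmpPrior.supp β) y = 0 := fun y => by
        rw [EmpPrior.modelPosterior_eq h (hX n), EmpPrior.modelPrior_eq_zero h hr, zero_mul,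
          ENNReal.zero_div]
      simp only [hz, lintegral_zero, nonpos_iff_eq_zero, tsub_eq_zero_iff_le] at h0
      exact absurd hη1 (not_lt.2 h0)
    -- For n ≥ 3 > e the logarithm is at least 1, so sparsity with constant 1 gives this bound.
    have hcard : ((EmpPrior.supp β).card : ℝ) ≤ √n := by
      refine (hn3 β hβ).trans ?_
      rw [one_mul]
      refine div_le_self (Real.sqrt_nonneg _) ?_
      rw [Real.le_log_iff_exp_le (by positivity)]
      have : (3 : ℝ) ≤ n := by exact_mod_cast hn4
      linarith [Real.exp_one_lt_d9]
    refine (EmpPrior.lintegral_tvDist_le h (hX n) (half_pos hx) hκ hgap β hrank hs hd1 hsd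
      (by omega) hcard).trans ?_
    have hsplit : η + η ≤ ε := by
      rw [hη, ENNReal.add_halves]; exact min_le_left _ _
    refine le_trans (add_le_add ?_ ?_) hsplit
    · rw [tsub_le_iff_left, ← tsub_le_iff_right]
      exact hn2 β hβ
    · refine (ENNReal.ofReal_le_ofReal (q := η.toReal) ?_).trans_eq (ENNReal.ofReal_toReal hηt)
      linarith
  refine ⟨fun n β _ => ⟨?_, ?_⟩, ?_, htv⟩
  · exact (EmpPrior.measurable_hellingerSq (EmpPrior.measurable_predictive h (hX n))
      (EmpPrior.measurable_normalPredictive h _)).aemeasurable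
  · exact (EmpPrior.measurable_tvDist (EmpPrior.measurable_predictive h (hX n))
      (EmpPrior.measurable_normalPredictive h _)).aemeasurable
  · have h2 : Tendsto (fun n => 2 * ⨆ β ∈ B n,
        ∫⁻ y, EmpPrior.tvDist (EmpPrior.predictive h (X n) (Xt n) y)
          (EmpPrior.normalPredictive h (X n) (Xt n) (sigma0 n) (EmpPrior.supp β) y)
          ∂(EmpPrior.dataLaw (X n) (sigma0 n) β)) atTop (𝓝 0) := by
      simpa using ENNReal.Tendsto.const_mul htv (Or.inr ENNReal.ofNat_ne_top)
    refine tendsto_of_tendsto_of_tendsto_of_le_of_le tendsto_const_nhds h2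
      (fun n => zero_le) fun n => iSup₂_le fun β hβ => ?_
    calc _ ≤ ∫⁻ y, 2 * EmpPrior.tvDist (EmpPrior.predictive h (X n) (Xt n) y)
          (EmpPrior.normalPredictive h (X n) (Xt n) (sigma0 n) (EmpPrior.supp β) y)
          ∂(EmpPrior.dataLaw (X n) (sigma0 n) β) :=
          lintegral_mono fun y => EmpPrior.hellingerSq_le_two_mul_tvDist _ _
      _ = 2 * ∫⁻ y, EmpPrior.tvDist (EmpPrior.predictive h (X n) (Xt n) y)
          (EmpPrior.normalPredictive h (X n) (Xt n) (sigma0 n) (EmpPrior.supp β) y)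
          ∂(EmpPrior.dataLaw (X n) (sigma0 n) β) := by
          rw [lintegral_const_mul' _ _ ENNReal.ofNat_ne_top]
      _ ≤ _ := by
          gcongr
          exact le_iSup₂ (f := fun β (_ : β ∈ B n) =>
            ∫⁻ y, EmpPrior.tvDist (EmpPrior.predictive h (X n) (Xt n) y)
              (EmpPrior.normalPredictive h (X n) (Xt n) (sigma0 n) (EmpPrior.supp β) y)
              ∂(EmpPrior.dataLaw (X n) (sigma0 n) β)) β hβ
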